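/- The cake is the interval $[0,1]$. A valuation is a continuous function $v:[0,1]^2\to[0,1]$ with $v(a,b)=0$ whenever $b\le a$; $v(a,b)$ is the value of the interval $[a,b]$. It is monotone if $v(a,b)\le v(a',b')$ for all $0\le a'\le a\le b\le b'\le 1$, and hungry if moreover $v(a,b)<v(a',b')$ whenever $[a,b]\subsetneq[a',b']$. It is piecewise linear if the triangle $\{0\le a\le b\le 1\}$ is a finite union of convex polytopes on each of which $v$ is affine. A division is a triple of cuts $(\ell,m,r)$ with $0\le\ell\le m\le r\le 1$; its pieces are $[0,\ell],[\ell,m],[m,r],[r,1]$. A connected allocation assigns the pieces of a division to the four agents, one to each; it is envy-free if every agent $i$ with valuation $v_i$ values its own piece at least as much as every other piece. A division is envy-free if some assignment of its pieces is envy-free. An agent weakly prefers a piece if it values no other piece of the division more. A division satisfies Condition A if there is a piece $k$ such that Agent 1 has the same value for the three other pieces and values piece $k$ at most as much, and at least two of the Agents 2, 3, 4 weakly prefer piece $k$. It satisfies Condition B if there are two distinct pieces $k,k'$ such that Agent 1 has the same value for the two other pieces and values each of $k,k'$ at most as much, and each of the pieces $k$ and $k'$ is weakly preferred by at least two of the Agents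 2, 3, 4. It satisfies the invariant if it satisfies Condition A or Condition B. **Theorem.** 1. For any four agents with monotone valuations $v_1,\dots,v_4$, a connected envy-free allocation exists. 2. If the four valuations are hungry, there is exactly one division whose four pieces all have the same value for Agent 1 (Agent 1's equipartition), and this division is envy-free or satisfies Condition A. 3. Suppose the four valuations are hungry and piecewise linear. Let $(\ell_0,m_0,r_0)$ be a division that satisfies the invariant, and let $\alpha_0$ be the value that Agent 1 has for its favorite pieces in it (its largest value for a piece). Then there are $\alpha^*\in[\alpha_0,1)$ and a continuous path $T:[\alpha_0,\alpha^*]\to\{(\ell,m,r):0\le\ell\le m\le r\le1\}$ such that $T(\alpha_0)=(\ell_0,m_0,r_0)$; for every $\alpha\in[\alpha_0,\alpha^*]$ the division $T(\alpha)$ satisfies the invariant and Agent 1 has value exactly $\alpha$ for its favorite pieces in $T(\alpha)$; and the division $T(\alpha^*)$ is envy-free. -/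

import Mathlib

/-- A valuation function on the cake `[0,1]`: `v a b` is the value of the interval `[a,b]`.
Only the values of `v` on `[0,1] × [0,1]` matter. -/
structure IsValuation (v : ℝ → ℝ → ℝ) : Prop where
  mem_Icc : ∀ a ∈ Set.Icc (0 : ℝ) 1, ∀ b ∈ Set.Icc (0 : ℝ) 1, v a b ∈ Set.Icc (0 : ℝ) 1
  eq_zero : ∀ a ∈ Set.Icc (0 : ℝ) 1, ∀ b ∈ Set.Icc (0 : ℝ) 1, b ≤ a → v a b = 0
  continuousOn :
    ContinuousOn (fun p : ℝ × ℝ => v p.1 p.2) (Set.Icc (0 : ℝ) 1 ×ˢ Set.Icc (0 : ℝ) 1)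

/-- Monotonicity: `v(a,b) ≤ v(a',b')` whenever `[a,b] ⊆ [a',b']`. -/
def IsMonotoneVal (v : ℝ → ℝ → ℝ) : Prop :=
  ∀ a b a' b' : ℝ, 0 ≤ a' → a' ≤ a → a ≤ b → b ≤ b' → b' ≤ 1 → v a b ≤ v a' b'

/-- Hungriness (strict monotonicity): `v(a,b) < v(a',b')` whenever `[a,b] ⊊ [a',b']`. -/
def IsHungryVal (v : ℝ → ℝ → ℝ) : Prop :=
  ∀ a b a' b' : ℝ, 0 ≤ a' → a' ≤ a → a ≤ b → b ≤ b' → b' ≤ 1 → (a' < a ∨ b < b') →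
    v a b < v a' b'

/-- Piecewise linearity: the triangle `{(a,b) : 0 ≤ a ≤ b ≤ 1}` is a finite union of convex
polytopes (convex hulls of finite sets), on each of which `v` is an affine function. -/
def IsPiecewiseLinearVal (v : ℝ → ℝ → ℝ) : Prop :=
  ∃ P : Finset (Finset (ℝ × ℝ)),
    (⋃ s ∈ P, convexHull ℝ (s : Set (ℝ × ℝ))) = {p : ℝ × ℝ | 0 ≤ p.1 ∧ p.1 ≤ p.2 ∧ p.2 ≤ 1} ∧
    ∀ s ∈ P, ∃ x y z : ℝ, ∀ p ∈ convexHull ℝ (s : Set (ℝ × ℝ)),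
      v p.1 p.2 = x * p.1 + y * p.2 + z

/-- The divisions of the cake into four connected pieces, given by the cuts `(ℓ, m, r)`. -/
def divisions : Set (ℝ × ℝ × ℝ) :=
  {d | 0 ≤ d.1 ∧ d.1 ≤ d.2.1 ∧ d.2.1 ≤ d.2.2 ∧ d.2.2 ≤ 1}

/-- The end points `0, ℓ, m, r, 1` of the pieces of a division. -/
def cutPoint (d : ℝ × ℝ × ℝ) : Fin 5 → ℝ := ![0, d.1, d.2.1, d.2.2, 1]

/-- The value under `v` of the `t`-th piece, counted from the left:
the pieces are `[0,ℓ]`, `[ℓ,m]`, `[m,r]`, `[r,1]`. -/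
def pieceValue (v : ℝ → ℝ → ℝ) (d : ℝ × ℝ × ℝ) (t : Fin 4) : ℝ :=
  v (cutPoint d t.castSucc) (cutPoint d t.succ)

/-- An agent with valuation `v` weakly prefers piece `k` in the division `d`. -/
def WeaklyPrefers (v : ℝ → ℝ → ℝ) (d : ℝ × ℝ × ℝ) (k : Fin 4) : Prop :=
  ∀ t : Fin 4, pieceValue v d t ≤ pieceValue v d k

/-- The connected allocation that gives piece `σ i` of the division `d` to agent `i`
is envy-free. -/
def IsEnvyFreeAllocation (v : Fin 4 → ℝ → ℝ → ℝ) (d : ℝ × ℝ × ℝ)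
    (σ : Equiv.Perm (Fin 4)) : Prop :=
  ∀ i j : Fin 4, pieceValue (v i) d (σ j) ≤ pieceValue (v i) d (σ i)

/-- A division is envy-free if its pieces can be assigned to the agents, one to each,
without envy. -/
def IsEnvyFreeDivision (v : Fin 4 → ℝ → ℝ → ℝ) (d : ℝ × ℝ × ℝ) : Prop :=
  ∃ σ : Equiv.Perm (Fin 4), IsEnvyFreeAllocation v d σ

/-- All four pieces of the division `d` have the same value according to `v`. -/
def IsEquipartition (v : ℝ → ℝ → ℝ) (d : ℝ × ℝ × ℝ) : Prop :=
  ∀ t t' : Fin 4, pieceValue v d t = pieceValue v d t'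

/-- Condition A (Agent 1 is the agent with index `0`): Agent 1 is indifferent between its three
favorite pieces, and the remaining piece `k` is weakly preferred by at least two of the three
other agents. -/
def ConditionA (v : Fin 4 → ℝ → ℝ → ℝ) (d : ℝ × ℝ × ℝ) : Prop :=
  ∃ k : Fin 4,
    (∀ t t' : Fin 4, t ≠ k → t' ≠ k →
      pieceValue (v 0) d t = pieceValue (v 0) d t' ∧
      pieceValue (v 0) d k ≤ pieceValue (v 0) d t) ∧
    ∃ i i' : Fin 4, i ≠ 0 ∧ i' ≠ 0 ∧ i ≠ i' ∧
      WeaklyPrefers (v i) d k ∧ WeaklyPrefers (v i') d k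

/-- Condition B: Agent 1 is indifferent between its two favorite pieces, and the two remaining
pieces `k`, `k'` are each weakly preferred by at least two of the three other agents. -/
def ConditionB (v : Fin 4 → ℝ → ℝ → ℝ) (d : ℝ × ℝ × ℝ) : Prop :=
  ∃ k k' : Fin 4, k ≠ k' ∧
    (∀ t t' : Fin 4, t ≠ k → t ≠ k' → t' ≠ k → t' ≠ k' →
      pieceValue (v 0) d t = pieceValue (v 0) d t' ∧
      max (pieceValue (v 0) d k) (pieceValue (v 0) d k') ≤ pieceValue (v 0) d t) ∧
    ∀ s : Fin 4, s = k ∨ s = k' →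
      ∃ i i' : Fin 4, i ≠ 0 ∧ i' ≠ 0 ∧ i ≠ i' ∧
        WeaklyPrefers (v i) d s ∧ WeaklyPrefers (v i') d s

/-- The invariant: Condition A or Condition B. -/
def Invariant (v : Fin 4 → ℝ → ℝ → ℝ) (d : ℝ × ℝ × ℝ) : Prop :=
  ConditionA v d ∨ ConditionB v d

/-- An agent with valuation `v` has value `α` for its favorite pieces in the division `d`. -/
def HasFavoriteValue (v : ℝ → ℝ → ℝ) (d : ℝ × ℝ × ℝ) (α : ℝ) : Prop :=
  IsGreatest (Set.range (pieceValue v d)) α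

/-!
Agent 1's favorite value serves as a clock. The key fact, `mem_closure_of_not_isEnvyFreeDivision`,
says that for hungry agents a division with the invariant that is not envy-free is a limit of
divisions with the invariant in which this value is strictly larger. All three claims follow from
it.

To see the key fact, match agents to pieces that they weakly prefer. If a division satisfies the
invariant but is not envy-free, then Hall-type counting (`preferences_of_conditionA`,
`preferences_of_conditionB`) leaves two cases. Either two of the Agents 2, 3, 4 accept only piece
`k`, and Agent 1 is indifferent between the three other pieces: raising these three to a slightly
larger common value `α` keeps Condition A. Or Agents 2, 3, 4 accept only two pieces `k`, `k'`, each
of which is accepted by at least two of them. Then raise the two other pieces to `α` and use the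
remaining degree of freedom to keep at zero the median over the three agents of the difference of
the values of `k` and `k'`; a zero median says exactly that each of `k`, `k'` is preferred by at
least two agents. This gives Condition B unless Agent 1 now values one of the two, say `k'`, at more
than `α`. In that case reduce `k'` to value `α` in favor of `k`: the median increases, so two
agents prefer `k`, and Condition A holds. Existence of these divisions rests on `exists_chart`
(values of three pieces determine the division, continuously), and all comparisons between
divisions rest on `exists_shrinking_piece`.

For hungry agents, the invariant holds at Agent 1's equipartition unless that is envy-free, and a
division with the invariant that maximizes Agent 1's favorite value must be envy-free. Monotone
valuations are limits of hungry ones. In the piecewise linear case the divisions with the invariant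
form a finite union of compact convex sets on each of which Agent 1's favorite value is affine. By
the key fact, a division that is not envy-free lies in one of these sets whose maximum of that value
is larger; the segment to a maximizer leaves this set behind for good, so finitely many segments
reach an envy-free division (`exists_increasing_path`).
-/

open Set Filter Topology

/-! ### Pieces of a division -/

lemma cutPoint_mem {d : ℝ × ℝ × ℝ} (hd : d ∈ divisions) (t : Fin 5) :
    cutPoint d t ∈ Icc (0 : ℝ) 1 := by
  obtain ⟨h0, h1, h2, h3⟩ := hd
  fin_cases t <;> simp [cutPoint] <;> constructor <;> linarith

lemma cutPoint_le {d : ℝ × ℝ × ℝ} (hd : d ∈ divisions) (t : Fin 4) :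
    cutPoint d t.castSucc ≤ cutPoint d t.succ := by
  obtain ⟨h0, h1, h2, h3⟩ := hd
  fin_cases t
  exacts [h0, h1, h2, h3]

lemma continuous_cutPoint (t : Fin 5) : Continuous fun d : ℝ × ℝ × ℝ => cutPoint d t := by
  fin_cases t
  · exact continuous_const
  · exact continuous_fst
  · exact continuous_fst.comp continuous_snd
  · exact continuous_snd.comp continuous_snd
  · exact continuous_const

lemma isCompact_divisions : IsCompact divisions := by
  have hsub : divisions ⊆ Icc 0 1 ×ˢ (Icc 0 1 ×ˢ Icc 0 1) := by
    rintro ⟨l, m, r⟩ ⟨h0, h1, h2, h3⟩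
    simp only at h0 h1 h2 h3
    refine ⟨⟨h0, ?_⟩, ⟨?_, ?_⟩, ⟨?_, h3⟩⟩ <;> simp only <;> linarith
  refine (isCompact_Icc.prod (isCompact_Icc.prod isCompact_Icc)).of_isClosed_subset ?_ hsub
  have := isClosed_le (continuous_const (y := (0 : ℝ))) (continuous_cutPoint 1)
  have h1 := isClosed_le (continuous_cutPoint 1) (continuous_cutPoint 2)
  have h2 := isClosed_le (continuous_cutPoint 2) (continuous_cutPoint 3)
  have h3 := isClosed_le (continuous_cutPoint 3) (continuous_const (y := (1 : ℝ)))
  exact this.inter (h1.inter (h2.inter h3))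

lemma convex_divisions : Convex ℝ divisions := by
  rintro ⟨l, m, r⟩ ⟨h0, h1, h2, h3⟩ ⟨l', m', r'⟩ ⟨h0', h1', h2', h3'⟩ a b ha hb hab
  simp only at *
  refine ⟨?_, ?_, ?_, ?_⟩ <;> simp only [Prod.smul_mk, Prod.mk_add_mk, smul_eq_mul]
  · positivity
  · gcongr
  · gcongr
  · nlinarith

lemma IsValuation.continuousOn_pieceValue {v : ℝ → ℝ → ℝ} (hv : IsValuation v) (t : Fin 4) :
    ContinuousOn (fun d => pieceValue v d t) divisions :=
  hv.continuousOn.comp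
    ((continuous_cutPoint t.castSucc).prodMk (continuous_cutPoint t.succ)).continuousOn
    fun _ hd => ⟨cutPoint_mem hd t.castSucc, cutPoint_mem hd t.succ⟩

/-- Of two different divisions, each has a piece that is a proper subinterval of the same piece of
the other. This comparison drives all uniqueness and monotonicity arguments: it holds for all
hungry agents simultaneously. -/
lemma exists_shrinking_piece {d d' : ℝ × ℝ × ℝ} (hd : d ∈ divisions) (hd' : d' ∈ divisions)
    (hne : d ≠ d') :
    ∃ t : Fin 4, ∀ v, IsHungryVal v → pieceValue v d t < pieceValue v d' t := by
  obtain ⟨l, m, r⟩ := d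
  obtain ⟨l', m', r'⟩ := d'
  obtain ⟨h0, h1, h2, h3⟩ := hd
  obtain ⟨h0', h1', h2', h3'⟩ := hd'
  simp only at h0 h1 h2 h3 h0' h1' h2' h3'
  by_cases c0 : l < l'
  · exact ⟨0, fun v hv => hv 0 l 0 l' le_rfl le_rfl h0 c0.le (by linarith) (Or.inr c0)⟩
  by_cases c1 : m < m'
  · exact ⟨1, fun v hv => hv l m l' m' h0' (by linarith) h1 c1.le (by linarith) (Or.inr c1)⟩
  by_cases c2 : r < r'
  · exact ⟨2, fun v hv => hv m r m' r' (by linarith) (by linarith) h2 c2.le (by linarith)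
      (Or.inr c2)⟩
  by_cases c3 : r' < r
  · exact ⟨3, fun v hv => hv r 1 r' 1 (by linarith) c3.le h3 le_rfl le_rfl (Or.inl c3)⟩
  by_cases c4 : m' < m
  · exact ⟨2, fun v hv => hv m r m' r' (by linarith) c4.le h2 (by linarith) h3' (Or.inl c4)⟩
  by_cases c5 : l' < l
  · exact ⟨1, fun v hv => hv l m l' m' h0' c5.le h1 (by linarith) (by linarith) (Or.inl c5)⟩
  refine absurd ?_ hne
  rw [Prod.mk.injEq, Prod.mk.injEq]
  refine ⟨?_, ?_, ?_⟩ <;> linarith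

lemma IsHungryVal.isMonotoneVal {v : ℝ → ℝ → ℝ} (hv : IsHungryVal v) : IsMonotoneVal v := by
  intro a b a' b' h0 h1 h2 h3 h4
  by_cases h : a' < a ∨ b < b'
  · exact (hv a b a' b' h0 h1 h2 h3 h4 h).le
  · push Not at h
    rw [le_antisymm h1 h.1, le_antisymm h3 h.2]

lemma pieceValue_nonneg {v : ℝ → ℝ → ℝ} (hv : IsValuation v) {d : ℝ × ℝ × ℝ}
    (hd : d ∈ divisions) (t : Fin 4) : 0 ≤ pieceValue v d t :=
  (hv.mem_Icc _ (cutPoint_mem hd _) _ (cutPoint_mem hd _)).1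

/-- A division all of whose pieces are nondegenerate is an interior point of the set of
divisions. -/
lemma divisions_mem_nhds {d : ℝ × ℝ × ℝ} (hd : d ∈ divisions)
    (hpos : ∀ t, ∃ v, IsValuation v ∧ 0 < pieceValue v d t) : divisions ∈ 𝓝 d := by
  have hlt : ∀ t : Fin 4, cutPoint d t.castSucc < cutPoint d t.succ := by
    intro t
    obtain ⟨v, hv, h⟩ := hpos t
    by_contra hle
    exact h.ne' (hv.eq_zero _ (cutPoint_mem hd _) _ (cutPoint_mem hd _) (not_lt.1 hle))
  have hev : ∀ᶠ d' in 𝓝 d, ∀ t : Fin 4, cutPoint d' t.castSucc < cutPoint d' t.succ :=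
    eventually_all.2 fun t => (continuous_cutPoint _).continuousAt.eventually_lt
      (continuous_cutPoint _).continuousAt (hlt t)
  filter_upwards [hev] with d' h
  exact ⟨(h 0).le, (h 1).le, (h 2).le, (h 3).le⟩

/-- An agent with a hungry valuation gives positive value to a piece that it weakly prefers. -/
lemma WeaklyPrefers.pos {v : ℝ → ℝ → ℝ} (hv : IsValuation v) (hh : IsHungryVal v)
    {d : ℝ × ℝ × ℝ} (hd : d ∈ divisions) {k : Fin 4} (hk : WeaklyPrefers v d k) :
    0 < pieceValue v d k := by
  by_contra hle
  have hz : ∀ t, pieceValue v d t = 0 := fun t =>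
    le_antisymm ((hk t).trans (not_lt.1 hle)) (pieceValue_nonneg hv hd t)
  have hcut : ∀ t : Fin 4, cutPoint d t.castSucc = cutPoint d t.succ := by
    intro t
    refine (cutPoint_le hd t).antisymm (not_lt.1 fun hlt => ?_)
    have h1 := hh _ _ _ _ (cutPoint_mem hd t.castSucc).1 le_rfl le_rfl (cutPoint_le hd t)
      (cutPoint_mem hd t.succ).2 (Or.inr hlt)
    rw [hv.eq_zero _ (cutPoint_mem hd _) _ (cutPoint_mem hd _) le_rfl] at h1
    exact h1.ne' (hz t)
  have h01 : (0 : ℝ) = 1 := (hcut 0).trans ((hcut 1).trans ((hcut 2).trans (hcut 3)))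
  exact zero_ne_one h01

/-! ### Divisions with prescribed values -/

/-- A jointly continuous function that is an increasing bijection in its second variable has a
jointly continuous inverse in that variable. -/
lemma exists_continuous_inverse {w : ℝ → ℝ → ℝ} (hc : Continuous fun p : ℝ × ℝ => w p.1 p.2)
    (hm : ∀ a, StrictMono (w a)) (hs : ∀ a, Function.Surjective (w a)) :
    ∃ R : ℝ → ℝ → ℝ, (Continuous fun p : ℝ × ℝ => R p.1 p.2) ∧
      (∀ a x, w a (R a x) = x) ∧ ∀ a b, R a (w a b) = b := by
  choose R hR using hs
  refine ⟨R, ?_, hR, fun a b => (hm a).injective (hR a _)⟩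
  rw [continuous_iff_continuousAt]
  rintro ⟨a, x⟩
  refine tendsto_order.2 ⟨fun b hb => ?_, fun b hb => ?_⟩
  · have h : w a b < x := hR a x ▸ hm a hb
    have hev : ∀ᶠ p : ℝ × ℝ in 𝓝 (a, x), w p.1 b < p.2 :=
      (hc.comp (continuous_fst.prodMk continuous_const)).continuousAt.eventually_lt
        continuous_snd.continuousAt h
    filter_upwards [hev] with p hp
    exact (hm p.1).lt_iff_lt.1 ((hR p.1 p.2).symm ▸ hp)
  · have h : x < w a b := by simpa only [hR] using hm a hb
    have hev : ∀ᶠ p : ℝ × ℝ in 𝓝 (a, x), p.2 < w p.1 b :=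
      continuous_snd.continuousAt.eventually_lt
        (hc.comp (continuous_fst.prodMk continuous_const)).continuousAt h
    filter_upwards [hev] with p hp
    exact (hm p.1).lt_iff_lt.1 ((hR p.1 p.2).symm ▸ hp)

/-- A hungry valuation extends from the triangle `0 ≤ a ≤ b ≤ 1` to a continuous function `w` on the
plane that is strictly monotone and onto in either variable. Hence either end of an interval is a
continuous function (`R`, resp. `L`) of the other end and the value. -/
lemma exists_extension {v : ℝ → ℝ → ℝ} (hv : IsValuation v) (hh : IsHungryVal v) :
    ∃ w R L : ℝ → ℝ → ℝ, (Continuous fun p : ℝ × ℝ => w p.1 p.2) ∧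
      (Continuous fun p : ℝ × ℝ => R p.1 p.2) ∧ (Continuous fun p : ℝ × ℝ => L p.1 p.2) ∧
      (∀ a, StrictMono (w a)) ∧ (∀ b, StrictAnti fun a => w a b) ∧ (∀ a, w a a = 0) ∧
      (∀ a b, 0 ≤ a → a ≤ b → b ≤ 1 → w a b = v a b) ∧
      (∀ a x, w a (R a x) = x) ∧ (∀ a b, R a (w a b) = b) ∧
      (∀ b x, w (L b x) b = x) ∧ (∀ a b, L b (w a b) = a) := by
  set c : ℝ → ℝ := fun x => max 0 (min 1 x) with hc
  have c0 : ∀ x, 0 ≤ c x := fun x => le_max_left _ _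
  have c1 : ∀ x, c x ≤ 1 := fun x => max_le zero_le_one (min_le_left _ _)
  have cmem : ∀ x, c x ∈ Icc (0 : ℝ) 1 := fun x => ⟨c0 x, c1 x⟩
  have ccont : Continuous c := by fun_prop
  have cid : ∀ x, 0 ≤ x → x ≤ 1 → c x = x := fun x h0 h1 => by simp [hc, h0, h1]
  have cmono : Monotone c := fun x y h => max_le_max_left _ (min_le_min_left _ h)
  have csub : ∀ x y, x ≤ y → x - c x ≤ y - c y := by
    intro x y h
    simp only [hc]
    rcases max_cases 0 (min 1 x) with h1 | h1 <;> rcases max_cases 0 (min 1 y) with h2 | h2 <;>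
    rcases min_cases 1 x with h3 | h3 <;> rcases min_cases 1 y with h4 | h4 <;> linarith
  have hmono := hh.isMonotoneVal
  -- Where the clamped valuation is constant, one of the last two summands makes `w` strict.
  set w : ℝ → ℝ → ℝ := fun a b => v (c a) (c b) + min 0 (b - a) + ((b - c b) - (a - c a)) with hw
  have wcont : Continuous fun p : ℝ × ℝ => w p.1 p.2 := by
    have h1 : Continuous fun p : ℝ × ℝ => v (c p.1) (c p.2) :=
      hv.continuousOn.comp_continuous (f := fun p : ℝ × ℝ => (c p.1, c p.2)) (by fun_prop)
        fun p => ⟨cmem _, cmem _⟩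
    exact (h1.add (continuous_const.min (continuous_snd.sub continuous_fst))).add
      ((continuous_snd.sub (ccont.comp continuous_snd)).sub
        (continuous_fst.sub (ccont.comp continuous_fst)))
  have wmono : ∀ a, StrictMono (w a) := by
    intro a b b' hb
    have h3 := csub b b' hb.le
    rcases lt_or_ge b a with h | h
    · have h1 : v (c a) (c b) = 0 := hv.eq_zero _ (cmem _) _ (cmem _) (cmono h.le)
      have h2 : 0 ≤ v (c a) (c b') := (hv.mem_Icc _ (cmem _) _ (cmem _)).1
      have h4 : min 0 (b - a) < min 0 (b' - a) := by
        rw [min_eq_right (by linarith)]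
        exact lt_min (by linarith) (by linarith)
      simp only [hw]
      linarith
    · have h4 : min 0 (b - a) = min 0 (b' - a) := by
        rw [min_eq_left (by linarith), min_eq_left (by linarith)]
      rcases (cmono hb.le).lt_or_eq with h5 | h5
      · have := hh (c a) (c b) (c a) (c b') (c0 a) le_rfl (cmono h) h5.le (c1 _) (Or.inr h5)
        simp only [hw]
        linarith
      · simp only [hw, h5, h4]
        linarith
  have wanti : ∀ b, StrictAnti fun a => w a b := by
    intro b a a' ha
    have h3 := csub a a' ha.le
    rcases lt_or_ge b a' with h | h
    · have h1 : v (c a') (c b) = 0 := hv.eq_zero _ (cmem _) _ (cmem _) (cmono h.le)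
      have h2 : 0 ≤ v (c a) (c b) := (hv.mem_Icc _ (cmem _) _ (cmem _)).1
      have h4 : min 0 (b - a') < min 0 (b - a) := by
        rw [min_eq_right (by linarith)]
        exact lt_min (by linarith) (by linarith)
      simp only [hw]
      linarith
    · have h4 : min 0 (b - a) = min 0 (b - a') := by
        rw [min_eq_left (by linarith), min_eq_left (by linarith)]
      rcases (cmono ha.le).lt_or_eq with h5 | h5
      · have := hh (c a') (c b) (c a) (c b) (c0 a) h5.le (cmono h) le_rfl (c1 _) (Or.inl h5)
        simp only [hw]
        linarith
      · simp only [hw, h5, h4]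
        linarith
  have lower : ∀ a b, a ≤ b → b - a - 1 ≤ w a b := by
    intro a b h
    have h1 := (hv.mem_Icc _ (cmem a) _ (cmem b)).1
    have := c0 a
    have := c1 b
    simp only [hw]
    rw [min_eq_left (by linarith)]
    linarith
  have upper : ∀ a b, b ≤ a → w a b ≤ b - a + 1 := by
    intro a b h
    have h1 := hv.eq_zero _ (cmem a) _ (cmem b) (cmono h)
    have := csub b a h
    simp only [hw, h1]
    rw [min_eq_right (by linarith)]
    linarith
  have hR : ∀ a, Function.Surjective (w a) := fun a x =>
    mem_range_of_exists_le_of_exists_ge (wcont.comp (continuous_const.prodMk continuous_id))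
      ⟨a - |x| - 1, (upper _ _ (by linarith [abs_nonneg x])).trans (by linarith [neg_abs_le x])⟩
      ⟨a + |x| + 1, le_trans (by linarith [le_abs_self x])
        (lower _ _ (by linarith [abs_nonneg x]))⟩
  have hL : ∀ b, Function.Surjective fun a => - w a b := fun b x =>
    mem_range_of_exists_le_of_exists_ge
      (wcont.comp (continuous_id.prodMk continuous_const)).neg
      ⟨b - |x| - 1, (neg_le_neg (lower _ b (by linarith [abs_nonneg x]))).trans
        (by linarith [neg_abs_le x])⟩
      ⟨b + |x| + 1, le_trans (by linarith [le_abs_self x])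
        (neg_le_neg (upper _ b (by linarith [abs_nonneg x])))⟩
  obtain ⟨R, Rc, R1, R2⟩ := exists_continuous_inverse wcont wmono hR
  obtain ⟨L, Lc, L1, L2⟩ := exists_continuous_inverse (w := fun b a => - w a b)
    (wcont.comp (continuous_snd.prodMk continuous_fst)).neg
    (fun b _ _ h => neg_lt_neg (wanti b h)) hL
  refine ⟨w, R, fun b x => L b (-x), wcont, Rc,
    Lc.comp (continuous_fst.prodMk continuous_snd.neg), wmono, wanti, ?_, ?_, R1, R2, ?_, ?_⟩
  · intro a
    simp [hw, hv.eq_zero _ (cmem a) _ (cmem a) le_rfl]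
  · intro a b h0 h1 h2
    simp only [hw]
    rw [cid a h0 (by linarith), cid b (by linarith) h2, min_eq_left (by linarith)]
    ring
  · intro b x
    linarith [L1 b (-x)]
  · exact fun a b => L2 b a

/-- For each piece `k`, a division is a continuous function of the values that a hungry agent gives
to the three other pieces. -/
lemma exists_chart {v : ℝ → ℝ → ℝ} (hv : IsValuation v) (hh : IsHungryVal v) (k : Fin 4) :
    ∃ Φ : (Fin 4 → ℝ) → ℝ × ℝ × ℝ, Continuous Φ ∧
      (∀ d ∈ divisions, Φ (pieceValue v d) = d) ∧
      ∀ x, Φ x ∈ divisions → ∀ t, t ≠ k → pieceValue v (Φ x) t = x t := by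
  obtain ⟨w, R, L, -, Rc, Lc, -, -, -, hwv, wR, Rw, wL, Lw⟩ := exists_extension hv hh
  have Rc' : ∀ f g : (Fin 4 → ℝ) → ℝ, Continuous f → Continuous g →
      Continuous fun x => R (f x) (g x) := fun f g hf hg => Rc.comp (hf.prodMk hg)
  have Lc' : ∀ f g : (Fin 4 → ℝ) → ℝ, Continuous f → Continuous g →
      Continuous fun x => L (f x) (g x) := fun f g hf hg => Lc.comp (hf.prodMk hg)
  have hpv : ∀ d ∈ divisions, v 0 d.1 = w 0 d.1 ∧ v d.1 d.2.1 = w d.1 d.2.1 ∧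
      v d.2.1 d.2.2 = w d.2.1 d.2.2 ∧ v d.2.2 1 = w d.2.2 1 := by
    rintro ⟨l, m, r⟩ ⟨h0, h1, h2, h3⟩
    simp only at *
    refine ⟨(hwv _ _ ?_ ?_ ?_).symm, (hwv _ _ ?_ ?_ ?_).symm, (hwv _ _ ?_ ?_ ?_).symm,
      (hwv _ _ ?_ ?_ ?_).symm⟩ <;> linarith
  have c : ∀ t : Fin 4, Continuous fun x : Fin 4 → ℝ => x t := fun t => continuous_apply t
  have main : ∃ Φ : (Fin 4 → ℝ) → ℝ × ℝ × ℝ, Continuous Φ ∧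
      (∀ d : ℝ × ℝ × ℝ, Φ ![w 0 d.1, w d.1 d.2.1, w d.2.1 d.2.2, w d.2.2 1] = d) ∧
      ∀ x t, t ≠ k → (![w 0 (Φ x).1, w (Φ x).1 (Φ x).2.1, w (Φ x).2.1 (Φ x).2.2,
        w (Φ x).2.2 1] : Fin 4 → ℝ) t = x t := by
    fin_cases k
    · refine ⟨fun x => (L (L (L 1 (x 3)) (x 2)) (x 1), L (L 1 (x 3)) (x 2), L 1 (x 3)), ?_, ?_, ?_⟩
      · have h3 := Lc' _ _ (continuous_const (y := (1 : ℝ))) (c 3)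
        have h2 := Lc' _ _ h3 (c 2)
        exact (Lc' _ _ h2 (c 1)).prodMk (h2.prodMk h3)
      · intro d; simp [Lw]
      · intro x t ht; fin_cases t <;> simp_all
    · refine ⟨fun x => (R 0 (x 0), L (L 1 (x 3)) (x 2), L 1 (x 3)), ?_, ?_, ?_⟩
      · have h3 := Lc' _ _ (continuous_const (y := (1 : ℝ))) (c 3)
        exact (Rc' _ _ continuous_const (c 0)).prodMk ((Lc' _ _ h3 (c 2)).prodMk h3)
      · intro d; simp [Lw, Rw]
      · intro x t ht; fin_cases t <;> simp_all
    · refine ⟨fun x => (R 0 (x 0), R (R 0 (x 0)) (x 1), L 1 (x 3)), ?_, ?_, ?_⟩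
      · have h0 := Rc' _ _ (continuous_const (y := (0 : ℝ))) (c 0)
        exact h0.prodMk ((Rc' _ _ h0 (c 1)).prodMk (Lc' _ _ continuous_const (c 3)))
      · intro d; simp [Lw, Rw]
      · intro x t ht; fin_cases t <;> simp_all
    · refine ⟨fun x => (R 0 (x 0), R (R 0 (x 0)) (x 1), R (R (R 0 (x 0)) (x 1)) (x 2)), ?_, ?_, ?_⟩
      · have h0 := Rc' _ _ (continuous_const (y := (0 : ℝ))) (c 0)
        have h1 := Rc' _ _ h0 (c 1)
        exact h0.prodMk (h1.prodMk (Rc' _ _ h1 (c 2)))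
      · intro d; simp [Rw]
      · intro x t ht; fin_cases t <;> simp_all
  have key : ∀ d ∈ divisions, pieceValue v d =
      ![w 0 d.1, w d.1 d.2.1, w d.2.1 d.2.2, w d.2.2 1] := by
    intro d hd
    obtain ⟨h0, h1, h2, h3⟩ := hpv d hd
    funext t
    fin_cases t
    exacts [h0, h1, h2, h3]
  obtain ⟨Φ, h1, h2, h3⟩ := main
  refine ⟨Φ, h1, fun d hd => by rw [key d hd, h2], fun x hx t ht => ?_⟩
  rw [key _ hx]
  exact h3 x t ht

/-- The cake has an equipartition. -/
lemma exists_isEquipartition {v : ℝ → ℝ → ℝ} (hv : IsValuation v) (hh : IsHungryVal v) :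
    ∃ d ∈ divisions, IsEquipartition v d := by
  obtain ⟨w, R, -, wc, Rc, -, wmono, wanti, w0, hwv, wR, Rw, -⟩ := exists_extension hv hh
  -- `l x`, `m x`, `r x` cut off three pieces of value `x` from the left.
  set l : ℝ → ℝ := fun x => R 0 x with hl
  set m : ℝ → ℝ := fun x => R (l x) x with hm
  set r : ℝ → ℝ := fun x => R (m x) x with hr
  have hlc : Continuous l := Rc.comp (continuous_const.prodMk continuous_id)
  have hmc : Continuous m := Rc.comp (hlc.prodMk continuous_id)
  have hrc : Continuous r := Rc.comp (hmc.prodMk continuous_id)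
  have hpos : ∀ a b, 0 < w a b ↔ a < b := fun a b => by
    rw [← w0 a]; exact (wmono a).lt_iff_lt
  have R0 : ∀ a, R a 0 = a := fun a => by rw [← w0 a, Rw]
  have h01 : 0 < w 0 1 := (hpos 0 1).2 one_pos
  have hfc : Continuous fun x => w (r x) 1 - x :=
    (wc.comp (hrc.prodMk continuous_const)).sub continuous_id
  have h1 : l (w 0 1) = 1 := Rw 0 1
  have hlt : ∀ a x, 0 < x → a < R a x := fun a x hx => (hpos a _).1 (by rwa [wR])
  have h2 : w (r (w 0 1)) 1 < 0 := by
    have h3 : 1 < r (w 0 1) := by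
      have e1 := hlt (l (w 0 1)) _ h01
      have e2 := hlt (m (w 0 1)) _ h01
      rw [h1] at e1
      have e3 : 1 < m (w 0 1) := by simpa only [hm, h1] using e1
      exact e3.trans e2
    have := wanti 1 h3
    simpa only [w0] using this
  obtain ⟨x, ⟨hx0, hx1⟩, hx⟩ := intermediate_value_Icc' h01.le hfc.continuousOn
    (show (0 : ℝ) ∈ Icc _ _ from ⟨by linarith, by simp only [hr, hm, hl, R0]; linarith⟩)
  have hx' : w (r x) 1 = x := by simpa [sub_eq_zero] using hx
  have hxpos : 0 < x := by
    rcases hx0.lt_or_eq with h | h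
    · exact h
    · subst h
      simp only [hr, hm, hl, R0] at hx'
      linarith
  have a1 : 0 < l x := hlt _ _ hxpos
  have a2 : l x < m x := hlt _ _ hxpos
  have a3 : m x < r x := hlt _ _ hxpos
  have a4 : r x < 1 := (hpos _ _).1 (by rwa [hx'])
  have hall : ∀ t, pieceValue v (l x, m x, r x) t = x := by
    intro t
    fin_cases t
    · exact (hwv _ _ le_rfl a1.le (by linarith)).symm.trans (wR _ _)
    · exact (hwv _ _ a1.le a2.le (by linarith)).symm.trans (wR _ _)
    · exact (hwv _ _ (by linarith) a3.le (by linarith)).symm.trans (wR _ _)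
    · exact (hwv _ _ (by linarith) a4.le le_rfl).symm.trans hx'
  exact ⟨(l x, m x, r x), ⟨a1.le, a2.le, a3.le, a4.le⟩, fun t t' => by rw [hall, hall]⟩

lemma IsEquipartition.unique {v : ℝ → ℝ → ℝ} (hh : IsHungryVal v) {d d' : ℝ × ℝ × ℝ}
    (hd : d ∈ divisions) (hd' : d' ∈ divisions) (he : IsEquipartition v d)
    (he' : IsEquipartition v d') : d = d' := by
  by_contra hne
  obtain ⟨t, ht⟩ := exists_shrinking_piece hd hd' hne
  obtain ⟨s, hs⟩ := exists_shrinking_piece hd' hd (Ne.symm hne)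
  have h1 := ht v hh
  have h2 := hs v hh
  rw [he t s, he' t s] at h1
  exact lt_asymm h1 h2

/-! ### Matching agents to preferred pieces -/

/-- The property `P` holds for at least two of the Agents 2, 3, 4 (those with nonzero index). -/
def TwoOthers (P : Fin 4 → Prop) : Prop :=
  ∃ i i' : Fin 4, i ≠ 0 ∧ i' ≠ 0 ∧ i ≠ i' ∧ P i ∧ P i'

lemma exists_third_agent : ∀ i i' : Fin 4, i ≠ 0 → i' ≠ 0 → i ≠ i' →
    ∃ j : Fin 4, j ≠ 0 ∧ i ≠ j ∧ i' ≠ j ∧ ∀ x : Fin 4, x ≠ 0 → x = i ∨ x = i' ∨ x = j := by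
  decide

lemma TwoOthers.mono {P Q : Fin 4 → Prop} (h : TwoOthers P) (hPQ : ∀ i, i ≠ 0 → P i → Q i) :
    TwoOthers Q := by
  obtain ⟨i, i', h1, h2, h3, h4, h5⟩ := h
  exact ⟨i, i', h1, h2, h3, hPQ _ h1 h4, hPQ _ h2 h5⟩

lemma twoOthers_iff {P : Fin 4 → Prop} :
    TwoOthers P ↔ (P 1 ∧ P 2) ∨ (P 1 ∧ P 3) ∨ (P 2 ∧ P 3) := by
  constructor
  · rintro ⟨i, i', h1, h2, h3, h4, h5⟩
    fin_cases i <;> fin_cases i' <;> simp_all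
  · rintro (h | h | h)
    exacts [⟨1, 2, by decide, by decide, by decide, h⟩, ⟨1, 3, by decide, by decide, by decide, h⟩,
      ⟨2, 3, by decide, by decide, by decide, h⟩]

lemma TwoOthers.resolve {P : Fin 4 → Prop} (h : TwoOthers P) {i i' j : Fin 4}
    (hall : ∀ x : Fin 4, x ≠ 0 → x = i ∨ x = i' ∨ x = j) :
    (P i ∧ P i') ∨ (P i ∧ P j) ∨ (P i' ∧ P j) := by
  obtain ⟨x, y, hx, hy, hxy, h1, h2⟩ := h
  rcases hall x hx with rfl | rfl | rfl <;> rcases hall y hy with rfl | rfl | rfl <;> tauto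

lemma exists_weaklyPrefers (v : ℝ → ℝ → ℝ) (d : ℝ × ℝ × ℝ) : ∃ t, WeaklyPrefers v d t :=
  Finite.exists_max (pieceValue v d)

lemma weaklyPrefers_of_three_pieces_eq {v : ℝ → ℝ → ℝ} {d : ℝ × ℝ × ℝ} {k : Fin 4}
    (h : ∀ t t' : Fin 4, t ≠ k → t' ≠ k →
      pieceValue v d t = pieceValue v d t' ∧ pieceValue v d k ≤ pieceValue v d t) (t : Fin 4)
    (ht : t ≠ k) : WeaklyPrefers v d t := by
  intro s
  by_cases hs : s = k
  · exact hs ▸ (h t t ht ht).2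
  · exact (h s t hs ht).1.le

lemma weaklyPrefers_of_two_pieces_eq {v : ℝ → ℝ → ℝ} {d : ℝ × ℝ × ℝ} {k k' : Fin 4}
    (h : ∀ t t' : Fin 4, t ≠ k → t ≠ k' → t' ≠ k → t' ≠ k' →
      pieceValue v d t = pieceValue v d t' ∧
      max (pieceValue v d k) (pieceValue v d k') ≤ pieceValue v d t) (t : Fin 4)
    (ht : t ≠ k) (ht' : t ≠ k') : WeaklyPrefers v d t := by
  intro s
  have h1 := (h t t ht ht' ht ht').2
  by_cases hs : s = k
  · exact hs ▸ (le_max_left _ _).trans h1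
  by_cases hs' : s = k'
  · exact hs' ▸ (le_max_right _ _).trans h1
  · exact (h s t hs hs' ht ht').1.le

lemma isEnvyFreeDivision_of_matching {v : Fin 4 → ℝ → ℝ → ℝ} {d : ℝ × ℝ × ℝ} {i j l a b c : Fin 4}
    (hi : i ≠ 0) (hj : j ≠ 0) (hl : l ≠ 0) (hij : i ≠ j) (hil : i ≠ l) (hjl : j ≠ l)
    (hab : a ≠ b) (hac : a ≠ c) (hbc : b ≠ c) (hia : WeaklyPrefers (v i) d a)
    (hjb : WeaklyPrefers (v j) d b) (hlc : WeaklyPrefers (v l) d c)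
    (h0 : ∀ t, t ≠ a → t ≠ b → t ≠ c → WeaklyPrefers (v 0) d t) : IsEnvyFreeDivision v d := by
  obtain ⟨e, hea, heb, hec⟩ : ∃ e : Fin 4, e ≠ a ∧ e ≠ b ∧ e ≠ c := by
    clear * -; revert a b c; decide
  have bij : ∀ x y z w : Fin 4, x ≠ y → x ≠ z → x ≠ w → y ≠ z → y ≠ w → z ≠ w →
      Function.Bijective ![x, y, z, w] := by
    intro x y z w h1 h2 h3 h4 h5 h6
    rw [← Finite.injective_iff_bijective]
    intro s t hst
    fin_cases s <;> fin_cases t <;> simp_all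
  -- Agent 1 receives the piece `e` that the three others leave.
  let τ := Equiv.ofBijective _ (bij 0 i j l hi.symm hj.symm hl.symm hij hil hjl)
  let ρ := Equiv.ofBijective _ (bij e a b c hea heb hec hab hac hbc)
  have key : ∀ s, WeaklyPrefers (v (τ s)) d (ρ s) := by
    intro s
    fin_cases s
    exacts [h0 e hea heb hec, hia, hjb, hlc]
  refine ⟨τ.symm.trans ρ, fun x y => ?_⟩
  have := key (τ.symm x)
  rw [Equiv.apply_symm_apply] at this
  exact this _

/-- If Agent 1 is content with any piece and no envy-free assignment exists, two of the others
compete for a piece. -/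
lemma exists_twoOthers_of_not_isEnvyFreeDivision {v : Fin 4 → ℝ → ℝ → ℝ} {d : ℝ × ℝ × ℝ}
    (h0 : ∀ t, WeaklyPrefers (v 0) d t) (hne : ¬ IsEnvyFreeDivision v d) :
    ∃ k, TwoOthers fun i => WeaklyPrefers (v i) d k := by
  obtain ⟨a, ha⟩ := exists_weaklyPrefers (v 1) d
  obtain ⟨b, hb⟩ := exists_weaklyPrefers (v 2) d
  obtain ⟨c, hc⟩ := exists_weaklyPrefers (v 3) d
  by_contra! hcon
  refine hne (isEnvyFreeDivision_of_matching (i := 1) (j := 2) (l := 3) (by decide) (by decide)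
    (by decide) (by decide) (by decide) (by decide) ?_ ?_ ?_ ha hb hc fun t _ _ _ => h0 t)
  · rintro rfl
    exact hcon _ (twoOthers_iff.2 (Or.inl ⟨ha, hb⟩))
  · rintro rfl
    exact hcon _ (twoOthers_iff.2 (Or.inr (Or.inl ⟨ha, hc⟩)))
  · rintro rfl
    exact hcon _ (twoOthers_iff.2 (Or.inr (Or.inr ⟨hb, hc⟩)))

/-- How Condition A can hold in a division that is not envy-free: either two of the other agents
insist on piece `k`, or the other agents care for two pieces only, and two of them compete for
each. -/
lemma preferences_of_conditionA {v : Fin 4 → ℝ → ℝ → ℝ} {d : ℝ × ℝ × ℝ} {k : Fin 4}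
    (hne : ¬ IsEnvyFreeDivision v d) (h0 : ∀ t, t ≠ k → WeaklyPrefers (v 0) d t)
    (hk : TwoOthers fun i => WeaklyPrefers (v i) d k) :
    (TwoOthers fun i => ∀ t, WeaklyPrefers (v i) d t → t = k) ∨
    ∃ k', k' ≠ k ∧ (TwoOthers fun i => WeaklyPrefers (v i) d k') ∧
      ∀ i, i ≠ 0 → ∀ t, WeaklyPrefers (v i) d t → t = k ∨ t = k' := by
  have aux : ∀ i j l, i ≠ 0 → j ≠ 0 → l ≠ 0 → i ≠ j → i ≠ l → j ≠ l →
      (∀ x : Fin 4, x ≠ 0 → x = i ∨ x = j ∨ x = l) →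
      WeaklyPrefers (v i) d k → WeaklyPrefers (v j) d k →
      ¬ (∀ t, WeaklyPrefers (v j) d t → t = k) → ¬ (∀ t, WeaklyPrefers (v l) d t → t = k) →
      ∃ k', k' ≠ k ∧ (TwoOthers fun i => WeaklyPrefers (v i) d k') ∧
        ∀ i, i ≠ 0 → ∀ t, WeaklyPrefers (v i) d t → t = k ∨ t = k' := by
    intro i j l hi hj hl hij hil hjl hall hik hjk hjo hlo
    push Not at hjo hlo
    obtain ⟨t, hjt, htk⟩ := hjo
    obtain ⟨s, hls, hsk⟩ := hlo
    -- Give `k` to agent `i`: the two others must compete for a single other piece.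
    have hsame : ∀ t s, WeaklyPrefers (v j) d t → t ≠ k → WeaklyPrefers (v l) d s → s ≠ k →
        t = s := by
      intro t s h1 h2 h3 h4
      by_contra hts
      exact hne (isEnvyFreeDivision_of_matching hi hj hl hij hil hjl h2.symm h4.symm hts hik h1 h3
        fun t' h _ _ => h0 t' h)
    obtain rfl := hsame t s hjt htk hls hsk
    refine ⟨t, htk, ⟨j, l, hj, hl, hjl, hjt, hls⟩, fun x hx y hy => ?_⟩
    rcases hall x hx with rfl | rfl | rfl
    · by_contra! hcon
      exact hne (isEnvyFreeDivision_of_matching hi hj hl hij hil hjl hcon.1 hcon.2 htk.symm hy hjk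
        hls fun t' _ h _ => h0 t' h)
    · by_contra! hcon
      exact hcon.2 (hsame y t hy hcon.1 hls htk)
    · by_contra! hcon
      exact hcon.2 (hsame t y hjt htk hy hcon.1).symm
  obtain ⟨i, i', hi, hi', hii', hik, hik'⟩ := hk
  obtain ⟨j, hj, hij, hij', hall⟩ := exists_third_agent i i' hi hi' hii'
  by_contra! hcon
  obtain ⟨honly, hB⟩ := hcon
  by_cases oi' : ∀ t, WeaklyPrefers (v i') d t → t = k
  · obtain ⟨k', h1, h2, h3⟩ := aux i' i j hi' hi hj hii'.symm hij' hij
      (fun x hx => by have := hall x hx; tauto) hik' hik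
      (fun h => honly ⟨i, i', hi, hi', hii', h, oi'⟩)
      (fun h => honly ⟨i', j, hi', hj, hij', oi', h⟩)
    obtain ⟨x, hx, t, ht, h4, h5⟩ := hB k' h1 h2
    exact (h3 x hx t ht).elim h4 h5
  by_cases oj : ∀ t, WeaklyPrefers (v j) d t → t = k
  · have hjk : WeaklyPrefers (v j) d k := by
      obtain ⟨t, ht⟩ := exists_weaklyPrefers (v j) d
      exact oj t ht ▸ ht
    obtain ⟨k', h1, h2, h3⟩ := aux j i' i hj hi' hi hij'.symm hij.symm hii'.symm
      (fun x hx => by have := hall x hx; tauto) hjk hik' oi'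
      (fun h => honly ⟨i, j, hi, hj, hij, h, oj⟩)
    obtain ⟨x, hx, t, ht, h4, h5⟩ := hB k' h1 h2
    exact (h3 x hx t ht).elim h4 h5
  · obtain ⟨k', h1, h2, h3⟩ := aux i i' j hi hi' hj hii' hij hij' hall hik hik' oi' oj
    obtain ⟨x, hx, t, ht, h4, h5⟩ := hB k' h1 h2
    exact (h3 x hx t ht).elim h4 h5

/-- If Condition B holds in a division that is not envy-free, the other agents care for the two
pieces `k`, `k'` only. -/
lemma preferences_of_conditionB {v : Fin 4 → ℝ → ℝ → ℝ} {d : ℝ × ℝ × ℝ} {k k' : Fin 4}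
    (hne : ¬ IsEnvyFreeDivision v d) (hkk' : k ≠ k')
    (h0 : ∀ t, t ≠ k → t ≠ k' → WeaklyPrefers (v 0) d t)
    (hk : TwoOthers fun i => WeaklyPrefers (v i) d k)
    (hk' : TwoOthers fun i => WeaklyPrefers (v i) d k') :
    ∀ i, i ≠ 0 → ∀ t, WeaklyPrefers (v i) d t → t = k ∨ t = k' := by
  have aux : ∀ i j l a, i ≠ 0 → j ≠ 0 → l ≠ 0 → i ≠ j → i ≠ l → j ≠ l →
      WeaklyPrefers (v i) d k → WeaklyPrefers (v j) d k' → WeaklyPrefers (v l) d a →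
      a ≠ k → a ≠ k' → False := fun i j l a hi hj hl hij hil hjl h1 h2 h3 h4 h5 =>
    hne (isEnvyFreeDivision_of_matching hi hj hl hij hil hjl hkk' h4.symm h5.symm h1 h2 h3
      fun t h h' _ => h0 t h h')
  intro i hi t hit
  by_contra! hcon
  obtain ⟨ht, ht'⟩ := hcon
  obtain ⟨j, hj, hij⟩ : ∃ j : Fin 4, j ≠ 0 ∧ i ≠ j := by clear hit; revert i; decide
  obtain ⟨l, hl, hil, hjl, hall⟩ := exists_third_agent i j hi hj hij
  have h1 := hk.resolve hall
  have h2 := hk'.resolve hall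
  have n1 := fun h h' => aux j l i t hj hl hi hjl hij.symm hil.symm h h' hit ht ht'
  have n2 := fun h h' => aux l j i t hl hj hi hjl.symm hil.symm hij.symm h h' hit ht ht'
  by_cases hjk : WeaklyPrefers (v j) d k
  · have hlk' := n1 hjk
    have hjk' : WeaklyPrefers (v j) d k' := by tauto
    have hik' : WeaklyPrefers (v i) d k' := by tauto
    obtain ⟨s, hs⟩ := exists_weaklyPrefers (v l) d
    exact aux j i l s hj hi hl hij.symm hjl hil hjk hik' hs (fun h => n2 (h ▸ hs) hjk')
      (fun h => hlk' (h ▸ hs))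
  · have hlk : WeaklyPrefers (v l) d k := by tauto
    have hjk' := n2 hlk
    have hik' : WeaklyPrefers (v i) d k' := by tauto
    obtain ⟨s, hs⟩ := exists_weaklyPrefers (v j) d
    exact aux l i j s hl hi hj hil.symm hjl.symm hij hlk hik' hs (fun h => hjk (h ▸ hs))
      (fun h => hjk' (h ▸ hs))

/-! ### Raising the value of Agent 1's favorite pieces -/

lemma eventually_exists_three_pieces_eq {v : ℝ → ℝ → ℝ} (hv : IsValuation v) (hh : IsHungryVal v)
    {d₀ : ℝ × ℝ × ℝ} (hd₀ : divisions ∈ 𝓝 d₀) {k : Fin 4} {α₀ : ℝ}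
    (h : ∀ t, t ≠ k → pieceValue v d₀ t = α₀) {U : Set (ℝ × ℝ × ℝ)} (hU : U ∈ 𝓝 d₀) :
    ∀ᶠ α in 𝓝 α₀, ∃ d ∈ U, d ∈ divisions ∧ ∀ t, t ≠ k → pieceValue v d t = α := by
  obtain ⟨Φ, hΦ, h1, h2⟩ := exists_chart hv hh k
  let x : ℝ → Fin 4 → ℝ := fun α t => if t = k then pieceValue v d₀ k else α
  have hx : Continuous x := by
    refine continuous_pi fun t => ?_
    by_cases ht : t = k
    · simpa [x, ht] using continuous_const
    · simpa [x, ht] using continuous_id'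
  have hx0 : Φ (x α₀) = d₀ := by
    rw [← h1 d₀ (mem_of_mem_nhds hd₀)]
    congr 1
    funext t
    by_cases ht : t = k
    · simp [x, ht]
    · simp [x, ht, h t ht]
  have hc : Tendsto (fun α => Φ (x α)) (𝓝 α₀) (𝓝 d₀) := by
    have h := (hΦ.comp hx).tendsto α₀
    rwa [Function.comp_apply, hx0] at h
  filter_upwards [hc (inter_mem hU hd₀)] with α hα
  refine ⟨Φ (x α), hα.1, hα.2, fun t ht => ?_⟩
  rw [h2 _ hα.2 t ht]
  simp [x, ht]

/-- Let Agent 1 give value `α₀` to the two pieces other than `k`, `k'`. Keeping these two values at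
a nearby `α` leaves one degree of freedom, along which `k` grows while `k'` shrinks. A function `g`
that increases along it keeps its zero. -/
lemma eventually_exists_two_pieces_eq {v : ℝ → ℝ → ℝ} (hv : IsValuation v) (hh : IsHungryVal v)
    {d₀ : ℝ × ℝ × ℝ} (hd₀ : divisions ∈ 𝓝 d₀) {k k' : Fin 4} (hkk' : k ≠ k') {α₀ : ℝ}
    (h : ∀ t, t ≠ k → t ≠ k' → pieceValue v d₀ t = α₀) {g : ℝ × ℝ × ℝ → ℝ}
    (hg : ContinuousOn g divisions) (hg0 : g d₀ = 0)
    (hmono : ∀ d ∈ divisions, ∀ d' ∈ divisions,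
      (∀ u, IsHungryVal u → pieceValue u d k < pieceValue u d' k) →
      (∀ u, IsHungryVal u → pieceValue u d' k' < pieceValue u d k') → g d < g d')
    {U : Set (ℝ × ℝ × ℝ)} (hU : U ∈ 𝓝 d₀) :
    ∀ᶠ α in 𝓝 α₀, ∃ d ∈ U, d ∈ divisions ∧
      (∀ t, t ≠ k → t ≠ k' → pieceValue v d t = α) ∧ g d = 0 := by
  obtain ⟨Φ, hΦ, h1, h2⟩ := exists_chart hv hh k
  have hmem₀ := mem_of_mem_nhds hd₀
  let x : ℝ × ℝ → Fin 4 → ℝ := fun p t =>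
    if t = k then pieceValue v d₀ k else if t = k' then p.2 else p.1
  have hx : Continuous x := by
    refine continuous_pi fun t => ?_
    by_cases ht : t = k
    · simpa [x, ht] using continuous_const
    by_cases ht' : t = k'
    · simpa [x, ht', hkk'.symm] using continuous_snd
    · simpa [x, ht, ht'] using continuous_fst
  set y₀ := pieceValue v d₀ k' with hy₀
  have hx0 : Φ (x (α₀, y₀)) = d₀ := by
    rw [← h1 d₀ hmem₀]
    congr 1
    funext t
    by_cases ht : t = k
    · simp [x, ht]
    by_cases ht' : t = k'
    · simp [x, ht', hkk'.symm, hy₀]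
    · simp [x, ht, ht', h t ht ht']
  let Ψ : ℝ × ℝ → ℝ × ℝ × ℝ := fun p => Φ (x p)
  have hΨ : Continuous Ψ := hΦ.comp hx
  have hΨ0 : Ψ (α₀, y₀) = d₀ := hx0
  have hval : ∀ p, Ψ p ∈ divisions → (∀ t, t ≠ k → t ≠ k' → pieceValue v (Ψ p) t = p.1) ∧
      pieceValue v (Ψ p) k' = p.2 := by
    intro p hp
    refine ⟨fun t ht ht' => ?_, ?_⟩
    · rw [h2 _ hp t ht]; simp [x, ht, ht']
    · rw [h2 _ hp k' hkk'.symm]; simp [x, hkk'.symm]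
  -- A larger value of `k'` means a smaller `k` and thus a smaller `g`.
  have hanti : ∀ α y y', y < y' → Ψ (α, y) ∈ divisions → Ψ (α, y') ∈ divisions →
      g (Ψ (α, y')) < g (Ψ (α, y)) := by
    intro α y y' hy hm hm'
    have hne : Ψ (α, y) ≠ Ψ (α, y') := by
      intro he
      have := (hval _ hm).2
      rw [he, (hval _ hm').2] at this
      exact hy.ne' this
    have cases : ∀ t, t ≠ k → t ≠ k' → pieceValue v (Ψ (α, y)) t = pieceValue v (Ψ (α, y')) t :=
      fun t ht ht' => by rw [(hval _ hm).1 t ht ht', (hval _ hm').1 t ht ht']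
    have hk' : pieceValue v (Ψ (α, y)) k' < pieceValue v (Ψ (α, y')) k' := by
      rw [(hval _ hm).2, (hval _ hm').2]
      exact hy
    obtain ⟨t, ht⟩ := exists_shrinking_piece hm hm' hne
    obtain ⟨s, hs⟩ := exists_shrinking_piece hm' hm hne.symm
    have hsk : s = k := by
      by_contra hsk
      by_cases hsk' : s = k'
      · exact lt_asymm hk' (hsk' ▸ hs v hh)
      · exact (hs v hh).ne (cases s hsk hsk').symm
    have htk : t = k' := by
      by_contra htk'
      by_cases htk : t = k
      · subst htk hsk
        exact lt_asymm (ht v hh) (hs v hh)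
      · exact (ht v hh).ne (cases t htk htk')
    subst hsk htk
    exact hmono _ hm' _ hm hs ht
  obtain ⟨η, hη, hball⟩ : ∃ η > 0, ∀ α y, |α - α₀| ≤ η → |y - y₀| ≤ η →
      Ψ (α, y) ∈ U ∩ divisions := by
    have hc : Tendsto Ψ (𝓝 (α₀, y₀)) (𝓝 d₀) := by simpa only [hΨ0] using hΨ.tendsto (α₀, y₀)
    obtain ⟨η, hη, hb⟩ := Metric.nhds_basis_closedBall.mem_iff.1 (hc (inter_mem hU hd₀))
    refine ⟨η, hη, fun α y h h' => hb ?_⟩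
    rw [Metric.mem_closedBall, Prod.dist_eq]
    exact max_le h h'
  have hη0 : |(0 : ℝ)| ≤ η := by simpa using hη.le
  have hcont : ∀ y, |y - y₀| ≤ η →
      ContinuousAt (fun α => g (Ψ (α, y))) α₀ := by
    intro y hy
    have : ContinuousOn (fun α => g (Ψ (α, y))) (Icc (α₀ - η) (α₀ + η)) :=
      hg.comp (hΨ.comp (by fun_prop)).continuousOn
        fun α hα => (hball α y (abs_le.2 ⟨by linarith [hα.1], by linarith [hα.2]⟩) hy).2
    exact this.continuousAt (Icc_mem_nhds (by linarith) (by linarith))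
  have hyp : |y₀ + η - y₀| ≤ η := by rw [add_sub_cancel_left, abs_of_pos hη]
  have hym : |y₀ - η - y₀| ≤ η := by rw [sub_sub_cancel_left, abs_neg, abs_of_pos hη]
  have hplus : g (Ψ (α₀, y₀ + η)) < 0 := by
    have := hanti α₀ y₀ (y₀ + η) (by linarith) (hball _ _ (by simpa using hη0) (by simpa using hη0)).2
      (hball _ _ (by simpa using hη0) hyp).2
    rwa [hΨ0, hg0] at this
  have hminus : 0 < g (Ψ (α₀, y₀ - η)) := by
    have := hanti α₀ (y₀ - η) y₀ (by linarith) (hball _ _ (by simpa using hη0) hym).2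
      (hball _ _ (by simpa using hη0) (by simpa using hη0)).2
    rwa [hΨ0, hg0] at this
  have hnear : ∀ᶠ α in 𝓝 α₀, |α - α₀| ≤ η := by
    filter_upwards [Metric.closedBall_mem_nhds α₀ hη] with α hα using hα
  filter_upwards [hnear, (hcont _ hyp).eventually_lt continuousAt_const hplus,
    continuousAt_const.eventually_lt (hcont _ hym) hminus] with α hα hlt hgt
  have hcy : ContinuousOn (fun y => g (Ψ (α, y))) (Icc (y₀ - η) (y₀ + η)) :=
    hg.comp (hΨ.comp (by fun_prop)).continuousOn
      fun y hy => (hball α y hα (abs_le.2 ⟨by linarith [hy.1], by linarith [hy.2]⟩)).2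
  obtain ⟨y, hy, hzero⟩ := intermediate_value_Icc' (by linarith) hcy ⟨hlt.le, hgt.le⟩
  have hb := hball α y hα (abs_le.2 ⟨by linarith [hy.1], by linarith [hy.2]⟩)
  exact ⟨Ψ (α, y), hb.1, hb.2, (hval _ hb.2).1, hzero⟩

/-- The median of three numbers: it is `≥ 0` (`≤ 0`) iff two of them are. -/
noncomputable def median (a b c : ℝ) : ℝ := max (min a b) (min (max a b) c)

lemma median_nonneg {f : Fin 4 → ℝ} :
    0 ≤ median (f 1) (f 2) (f 3) ↔ TwoOthers fun i => 0 ≤ f i := by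
  rw [twoOthers_iff]
  simp only [median, le_max_iff, le_min_iff]
  tauto

lemma median_nonpos {f : Fin 4 → ℝ} :
    median (f 1) (f 2) (f 3) ≤ 0 ↔ TwoOthers fun i => f i ≤ 0 := by
  rw [twoOthers_iff]
  simp only [median, max_le_iff, min_le_iff]
  tauto

lemma median_lt_median {a b c a' b' c' : ℝ} (ha : a < a') (hb : b < b') (hc : c < c') :
    median a b c < median a' b' c' :=
  max_lt_max (min_lt_min ha hb) (min_lt_min (max_lt_max ha hb) hc)

/-- If, from `d₀` to `d`, Agent 1's value rises for every piece except `k`, then `k` shrinks. -/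
lemma pieceValue_lt_of_rising {v : ℝ → ℝ → ℝ} (hh : IsHungryVal v) {d₀ d : ℝ × ℝ × ℝ}
    (hd₀ : d₀ ∈ divisions) (hd : d ∈ divisions) {k : Fin 4}
    (h : ∀ t, t ≠ k → pieceValue v d₀ t < pieceValue v d t) :
    pieceValue v d k < pieceValue v d₀ k := by
  have hne : d ≠ d₀ := by
    rintro rfl
    obtain ⟨t, ht⟩ := exists_ne k
    exact (h t ht).false
  obtain ⟨t, ht⟩ := exists_shrinking_piece hd hd₀ hne
  by_cases htk : t = k
  · exact htk ▸ ht v hh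
  · exact absurd (ht v hh) (h t htk).le.not_gt

/-- The other agents keep disliking pieces that they disliked in a nearby division. -/
lemma eventually_prefers_subset {v : Fin 4 → ℝ → ℝ → ℝ} (hv : ∀ i, IsValuation (v i))
    {d₀ : ℝ × ℝ × ℝ} (hd₀ : divisions ∈ 𝓝 d₀) (i : Fin 4) {s : Fin 4 → Prop}
    (h : ∀ t, WeaklyPrefers (v i) d₀ t → s t) :
    ∀ᶠ d in 𝓝 d₀, ∀ t, WeaklyPrefers (v i) d t → s t := by
  refine eventually_all.2 fun t => ?_
  by_cases hs : s t
  · exact Eventually.of_forall fun _ _ => hs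
  have hnot : ¬ WeaklyPrefers (v i) d₀ t := fun h' => hs (h t h')
  simp only [WeaklyPrefers] at hnot
  push Not at hnot
  obtain ⟨t', ht'⟩ := hnot
  filter_upwards [(((hv i).continuousOn_pieceValue t).continuousAt hd₀).eventually_lt
    (((hv i).continuousOn_pieceValue t').continuousAt hd₀) ht'] with d hd h'
  exact absurd (h' t') hd.not_ge

/-- Condition A from three pieces raised to a common value. -/
lemma conditionA_of_rising {v : Fin 4 → ℝ → ℝ → ℝ} (hh : ∀ i, IsHungryVal (v i))
    {d₀ d : ℝ × ℝ × ℝ} (hd₀ : d₀ ∈ divisions) (hd : d ∈ divisions) {k : Fin 4} {α₀ α : ℝ}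
    (hα : α₀ < α) (hle : ∀ t, pieceValue (v 0) d₀ t ≤ α₀)
    (h : ∀ t, t ≠ k → pieceValue (v 0) d t = α)
    (hk : TwoOthers fun i => WeaklyPrefers (v i) d k) : ConditionA v d := by
  have hkα : pieceValue (v 0) d k < α :=
    (pieceValue_lt_of_rising (hh 0) hd₀ hd fun t ht =>
      ((hle t).trans_lt hα).trans_eq (h t ht).symm).trans ((hle k).trans_lt hα)
  exact ⟨k, fun t t' ht ht' => ⟨by rw [h t ht, h t' ht'], by rw [h t ht]; exact hkα.le⟩, hk⟩

/-- Suppose that in `d` Condition B fails only because Agent 1 values piece `k'` at more than `α`.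
Shrinking `k'` in favor of `k` leads to Condition A. -/
lemma conditionA_of_overshoot {v : Fin 4 → ℝ → ℝ → ℝ} (hh : ∀ i, IsHungryVal (v i))
    {d₀ d d' : ℝ × ℝ × ℝ} (hd₀ : d₀ ∈ divisions) (hd : d ∈ divisions) (hd' : d' ∈ divisions)
    {k k' : Fin 4} {α₀ α : ℝ} (hα : α₀ < α) (hle : ∀ t, pieceValue (v 0) d₀ t ≤ α₀)
    (h : ∀ t, t ≠ k → t ≠ k' → pieceValue (v 0) d t = α)
    (h' : ∀ t, t ≠ k → pieceValue (v 0) d' t = α) (hover : α < pieceValue (v 0) d k')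
    (hlikes : ∀ i, i ≠ 0 → ∀ t, WeaklyPrefers (v i) d' t → t = k ∨ t = k')
    (hk : TwoOthers fun i => pieceValue (v i) d k' ≤ pieceValue (v i) d k) : ConditionA v d' := by
  refine conditionA_of_rising hh hd₀ hd' hα hle h' (hk.mono fun i hi hik => ?_)
  have hkk' : k' ≠ k := by
    rintro rfl
    have h0 := pieceValue_lt_of_rising (hh 0) hd₀ hd fun t ht =>
      ((hle t).trans_lt hα).trans_eq (h t ht ht).symm
    linarith [hle k']
  have hk' : pieceValue (v 0) d' k' < pieceValue (v 0) d k' := by rwa [h' k' hkk']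
  have hne : d' ≠ d := by rintro rfl; exact hk'.false
  obtain ⟨t, ht⟩ := exists_shrinking_piece hd' hd hne
  obtain ⟨s, hs⟩ := exists_shrinking_piece hd hd' hne.symm
  have heq : ∀ t, t ≠ k → t ≠ k' → pieceValue (v 0) d t = pieceValue (v 0) d' t :=
    fun t h1 h2 => by rw [h t h1 h2, h' t h1]
  have hsk : s = k := by
    by_contra hsk
    by_cases hsk' : s = k'
    · exact lt_asymm hk' (hsk' ▸ hs _ (hh 0))
    · exact (hs _ (hh 0)).ne (heq s hsk hsk')
  have htk : t = k' := by
    by_contra htk'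
    by_cases htk : t = k
    · subst htk hsk
      exact lt_asymm (ht _ (hh 0)) (hs _ (hh 0))
    · exact (ht _ (hh 0)).ne (heq t htk htk').symm
  have hlt : pieceValue (v i) d' k' < pieceValue (v i) d' k :=
    (htk ▸ ht _ (hh i)).trans_le (hik.trans (hsk ▸ hs _ (hh i)).le)
  obtain ⟨p, hp⟩ := exists_weaklyPrefers (v i) d'
  rcases hlikes i hi p hp with rfl | rfl
  · exact hp
  · exact absurd (hp k) hlt.not_ge

/-- The heart of the argument: as long as a division with the invariant is not envy-free, there are
arbitrarily close divisions that satisfy the invariant and in which Agent 1's favorite pieces are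
worth more. -/
theorem mem_closure_of_not_isEnvyFreeDivision {v : Fin 4 → ℝ → ℝ → ℝ}
    (hv : ∀ i, IsValuation (v i)) (hh : ∀ i, IsHungryVal (v i)) {d₀ : ℝ × ℝ × ℝ}
    (hd₀ : d₀ ∈ divisions) (hinv : Invariant v d₀) (hne : ¬ IsEnvyFreeDivision v d₀) {α₀ : ℝ}
    (hα₀ : HasFavoriteValue (v 0) d₀ α₀) :
    d₀ ∈ closure {d | d ∈ divisions ∧ Invariant v d ∧ ∃ t, α₀ < pieceValue (v 0) d t} := by
  have hle : ∀ t, pieceValue (v 0) d₀ t ≤ α₀ := fun t => hα₀.2 ⟨t, rfl⟩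
  obtain ⟨q, hq⟩ := hα₀.1
  rw [mem_closure_iff_nhds]
  intro U hU
  have hfav : ∀ t, pieceValue (v 0) d₀ t = α₀ ↔ WeaklyPrefers (v 0) d₀ t := fun t =>
    ⟨fun h s => (hle s).trans_eq h.symm, fun h => (hle t).antisymm (hq ▸ h q)⟩
  -- Every piece has a positive value for an agent who likes it.
  have hnhds : (∀ t, ∃ i, WeaklyPrefers (v i) d₀ t) → divisions ∈ 𝓝 d₀ := fun h =>
    divisions_mem_nhds hd₀ fun t => by
      obtain ⟨i, hi⟩ := h t
      exact ⟨v i, hv i, hi.pos (hv i) (hh i) hd₀⟩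
  -- `α` slightly above `α₀`
  have hgt : ∀ {P : ℝ → Prop}, (∀ᶠ α in 𝓝 α₀, P α) → ∃ α, α₀ < α ∧ P α := fun hP =>
    (hP.filter_mono nhdsWithin_le_nhds |>.and self_mem_nhdsWithin).exists (f := 𝓝[>] α₀)
      |>.imp fun _ h => ⟨h.2, h.1⟩
  -- Two of the other agents insist on piece `k`: raise the three other pieces.
  have easy : ∀ k, (∀ t, t ≠ k → WeaklyPrefers (v 0) d₀ t) →
      (TwoOthers fun i => ∀ t, WeaklyPrefers (v i) d₀ t → t = k) →
      (U ∩ {d | d ∈ divisions ∧ Invariant v d ∧ ∃ t, α₀ < pieceValue (v 0) d t}).Nonempty := by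
    intro k h0 hk
    have hlikes : ∀ d i, (∀ t, WeaklyPrefers (v i) d t → t = k) → WeaklyPrefers (v i) d k := by
      intro d i h
      obtain ⟨t, ht⟩ := exists_weaklyPrefers (v i) d
      exact h t ht ▸ ht
    have hn : divisions ∈ 𝓝 d₀ := hnhds fun t => by
      by_cases ht : t = k
      · obtain ⟨i, -, -, -, -, hi, -⟩ := hk
        exact ⟨i, ht ▸ hlikes _ i hi⟩
      · exact ⟨0, h0 t ht⟩
    obtain ⟨i, i', hi, hi', hii', hki, hki'⟩ := hk
    have hV := inter_mem (inter_mem hU (eventually_prefers_subset hv hn i hki))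
      (eventually_prefers_subset hv hn i' hki')
    obtain ⟨α, hα, d, ⟨⟨hdU, hdi⟩, hdi'⟩, hd, hdα⟩ := hgt (eventually_exists_three_pieces_eq (hv 0)
      (hh 0) hn (fun t ht => (hfav t).2 (h0 t ht)) hV)
    obtain ⟨t, ht⟩ := exists_ne k
    exact ⟨d, hdU, hd, Or.inl (conditionA_of_rising hh hd₀ hd hα hle hdα
      ⟨i, i', hi, hi', hii', hlikes d i hdi, hlikes d i' hdi'⟩), t, by rwa [hdα t ht]⟩
  -- The other agents care for `k`, `k'` only: keep the median agent indifferent between the two.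
  have hard : ∀ k k', k ≠ k' → (∀ t, t ≠ k → t ≠ k' → WeaklyPrefers (v 0) d₀ t) →
      (TwoOthers fun i => WeaklyPrefers (v i) d₀ k) →
      (TwoOthers fun i => WeaklyPrefers (v i) d₀ k') →
      (∀ i, i ≠ 0 → ∀ t, WeaklyPrefers (v i) d₀ t → t = k ∨ t = k') →
      (U ∩ {d | d ∈ divisions ∧ Invariant v d ∧ ∃ t, α₀ < pieceValue (v 0) d t}).Nonempty := by
    intro k k' hkk' h0 hk hk' hlikes
    have hn : divisions ∈ 𝓝 d₀ := hnhds fun t => by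
      by_cases ht : t = k
      · obtain ⟨i, -, -, -, -, hi, -⟩ := hk
        exact ⟨i, ht ▸ hi⟩
      by_cases ht' : t = k'
      · obtain ⟨i, -, -, -, -, hi, -⟩ := hk'
        exact ⟨i, ht' ▸ hi⟩
      · exact ⟨0, h0 t ht ht'⟩
    have hlikes_ev : ∀ᶠ d in 𝓝 d₀, ∀ i, i ≠ 0 → ∀ t, WeaklyPrefers (v i) d t → t = k ∨ t = k' :=
      eventually_all.2 fun i => by
        by_cases hi : i = 0
        · exact Eventually.of_forall fun _ h => absurd hi h
        · filter_upwards [eventually_prefers_subset hv hn i (hlikes i hi)] with d hd _ using hd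
    have hsmall_ev : ∀ᶠ d in 𝓝 d₀, ∀ t, pieceValue (v 0) d₀ t < α₀ → pieceValue (v 0) d t < α₀ :=
      eventually_all.2 fun t => by
        by_cases ht : pieceValue (v 0) d₀ t < α₀
        · filter_upwards [(((hv 0).continuousOn_pieceValue t).continuousAt hn).eventually_lt
            continuousAt_const ht] with d hd _ using hd
        · exact Eventually.of_forall fun _ h => absurd h ht
    have hV := inter_mem (inter_mem hU hlikes_ev) hsmall_ev
    let f : ℝ × ℝ × ℝ → Fin 4 → ℝ := fun d i => pieceValue (v i) d k - pieceValue (v i) d k'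
    have hf : ∀ i, ContinuousOn (fun d => f d i) divisions := fun i =>
      ((hv i).continuousOn_pieceValue k).sub ((hv i).continuousOn_pieceValue k')
    let g : ℝ × ℝ × ℝ → ℝ := fun d => median (f d 1) (f d 2) (f d 3)
    have hg : ContinuousOn g divisions :=
      ((hf 1).inf (hf 2)).sup (((hf 1).sup (hf 2)).inf (hf 3))
    have hg0 : g d₀ = 0 := le_antisymm
      (median_nonpos.2 (hk'.mono fun i _ hi => sub_nonpos.2 (hi k)))
      (median_nonneg.2 (hk.mono fun i _ hi => sub_nonneg.2 (hi k')))
    have hgm : ∀ d ∈ divisions, ∀ d' ∈ divisions,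
        (∀ u, IsHungryVal u → pieceValue u d k < pieceValue u d' k) →
        (∀ u, IsHungryVal u → pieceValue u d' k' < pieceValue u d k') → g d < g d' := by
      intro d _ d' _ h1 h2
      exact median_lt_median (sub_lt_sub (h1 _ (hh 1)) (h2 _ (hh 1)))
        (sub_lt_sub (h1 _ (hh 2)) (h2 _ (hh 2))) (sub_lt_sub (h1 _ (hh 3)) (h2 _ (hh 3)))
    have hB := eventually_exists_two_pieces_eq (hv 0) (hh 0) hn hkk'
      (fun t ht ht' => (hfav t).2 (h0 t ht ht')) hg hg0 hgm hV
    have hA : ∀ a b, (a = k ∧ b = k' ∨ a = k' ∧ b = k) → ∀ᶠ α in 𝓝 α₀,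
        pieceValue (v 0) d₀ b = α₀ →
        ∃ d ∈ (U ∩ {d | ∀ i, i ≠ 0 → ∀ t, WeaklyPrefers (v i) d t → t = k ∨ t = k'}) ∩
          {d | ∀ t, pieceValue (v 0) d₀ t < α₀ → pieceValue (v 0) d t < α₀},
          d ∈ divisions ∧ ∀ t, t ≠ a → pieceValue (v 0) d t = α := by
      intro a b hab
      by_cases hb : pieceValue (v 0) d₀ b = α₀
      · have := eventually_exists_three_pieces_eq (hv 0) (hh 0) hn (k := a) (α₀ := α₀) (fun t ht => by
          by_cases htb : t = b
          · rw [htb, hb]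
          · refine (hfav t).2 (h0 t ?_ ?_) <;> rcases hab with ⟨rfl, rfl⟩ | ⟨rfl, rfl⟩ <;>
              assumption) hV
        filter_upwards [this] with α h _ using h
      · exact Eventually.of_forall fun _ h => absurd h hb
    obtain ⟨α, hα, ⟨d, ⟨⟨hdU, hdl⟩, hds⟩, hd, hdα, hdg⟩, hAk, hAk'⟩ := hgt (hB.and
      ((hA k k' (Or.inl ⟨rfl, rfl⟩)).and (hA k' k (Or.inr ⟨rfl, rfl⟩))))
    have hnonneg : TwoOthers fun i => 0 ≤ f d i := median_nonneg.1 hdg.ge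
    have hnonpos : TwoOthers fun i => f d i ≤ 0 := median_nonpos.1 hdg.le
    -- If Agent 1 overrates one of `k`, `k'` in `d`, it does so for a favorite piece of `d₀`.
    have htight : ∀ t, α < pieceValue (v 0) d t → pieceValue (v 0) d₀ t = α₀ := by
      intro t ht
      by_contra hlt
      linarith [hds t (lt_of_le_of_ne (hle t) hlt)]
    by_cases hover' : α < pieceValue (v 0) d k'
    · obtain ⟨d', ⟨⟨hdU', hdl'⟩, -⟩, hd', hdα'⟩ := hAk (htight k' hover')
      obtain ⟨t, ht⟩ := exists_ne k
      exact ⟨d', hdU', hd', Or.inl (conditionA_of_overshoot hh hd₀ hd hd' hα hle hdα hdα' hover'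
        hdl' (hnonneg.mono fun i _ hi => sub_nonneg.1 hi)), t, by rwa [hdα' t ht]⟩
    by_cases hover : α < pieceValue (v 0) d k
    · obtain ⟨d', ⟨⟨hdU', hdl'⟩, -⟩, hd', hdα'⟩ := hAk' (htight k hover)
      obtain ⟨t, ht⟩ := exists_ne k'
      exact ⟨d', hdU', hd', Or.inl (conditionA_of_overshoot hh hd₀ hd hd' hα hle
        (fun t h1 h2 => hdα t h2 h1) hdα' hover (fun i hi t ht => (hdl' i hi t ht).symm)
        (hnonpos.mono fun i _ hi => sub_nonpos.1 hi)), t, by rwa [hdα' t ht]⟩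
    obtain ⟨p, hpk, hpk'⟩ : ∃ p : Fin 4, p ≠ k ∧ p ≠ k' := by
      clear * -; revert k k'; decide
    refine ⟨d, hdU, hd, Or.inr ⟨k, k', hkk', fun t t' ht1 ht2 ht1' ht2' => ?_, ?_⟩, p, ?_⟩
    · rw [hdα t ht1 ht2, hdα t' ht1' ht2']
      exact ⟨rfl, max_le (not_lt.1 hover) (not_lt.1 hover')⟩
    · have hwp : ∀ i, i ≠ 0 → ∀ s s', (∀ t, t = k ∨ t = k' → t = s ∨ t = s') →
          pieceValue (v i) d s' ≤ pieceValue (v i) d s → WeaklyPrefers (v i) d s := by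
        intro i hi s s' hss' hle
        obtain ⟨t, ht⟩ := exists_weaklyPrefers (v i) d
        rcases hss' t (hdl i hi t ht) with rfl | rfl
        · exact ht
        · exact fun t' => (ht t').trans hle
      rintro s (rfl | rfl)
      · exact hnonneg.mono fun i hi h => hwp i hi _ k' (fun t => id) (sub_nonneg.1 h)
      · exact hnonpos.mono fun i hi h => hwp i hi _ k (fun t => Or.symm) (sub_nonpos.1 h)
    · rwa [hdα p hpk hpk']
  rcases hinv with ⟨k, h1, hk⟩ | ⟨k, k', hkk', h1, h2⟩
  · have h0 := weaklyPrefers_of_three_pieces_eq h1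
    rcases preferences_of_conditionA hne h0 hk with h | ⟨k', hk', h3, h4⟩
    · exact easy k h0 h
    · exact hard k k' hk'.symm (fun t ht _ => h0 t ht) hk h3 h4
  · have h0 := weaklyPrefers_of_two_pieces_eq h1
    have hk := h2 k (Or.inl rfl)
    have hk' := h2 k' (Or.inr rfl)
    exact hard k k' hkk' h0 hk hk' (preferences_of_conditionB hne hkk' h0 hk hk')

/-! ### The invariant as a system of comparisons -/

/-- All comparisons `(i, t, t')`: Agent `i` values piece `t` at most as much as piece `t'`. -/
def comparisons (v : Fin 4 → ℝ → ℝ → ℝ) (d : ℝ × ℝ × ℝ) : Set (Fin 4 × Fin 4 × Fin 4) :=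
  {p | pieceValue (v p.1) d p.2.1 ≤ pieceValue (v p.1) d p.2.2}

/-- The divisions in which all comparisons listed in `Q` hold. -/
def comparisonSet (v : Fin 4 → ℝ → ℝ → ℝ) (Q : Set (Fin 4 × Fin 4 × Fin 4)) : Set (ℝ × ℝ × ℝ) :=
  {d | d ∈ divisions ∧ Q ⊆ comparisons v d}

lemma Invariant.mono {v : Fin 4 → ℝ → ℝ → ℝ} {d d' : ℝ × ℝ × ℝ} (h : Invariant v d)
    (hdd' : comparisons v d ⊆ comparisons v d') : Invariant v d' := by
  have key : ∀ i t t', pieceValue (v i) d t ≤ pieceValue (v i) d t' →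
      pieceValue (v i) d' t ≤ pieceValue (v i) d' t' := fun i t t' h => @hdd' (i, t, t') h
  have hw : ∀ i k, WeaklyPrefers (v i) d k → WeaklyPrefers (v i) d' k :=
    fun i k h t => key i t k (h t)
  rcases h with ⟨k, h1, hk⟩ | ⟨k, k', hkk', h1, h2⟩
  · refine Or.inl ⟨k, fun t t' ht ht' => ?_, TwoOthers.mono hk fun i _ => hw i k⟩
    obtain ⟨h2, h3⟩ := h1 t t' ht ht'
    exact ⟨(key _ _ _ h2.le).antisymm (key _ _ _ h2.ge), key _ _ _ h3⟩
  · refine Or.inr ⟨k, k', hkk', fun t t' h3 h4 h5 h6 => ?_,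
      fun s hs => TwoOthers.mono (h2 s hs) fun i _ => hw i s⟩
    obtain ⟨h7, h8⟩ := h1 t t' h3 h4 h5 h6
    exact ⟨(key _ _ _ h7.le).antisymm (key _ _ _ h7.ge),
      max_le (key _ _ _ ((le_max_left _ _).trans h8)) (key _ _ _ ((le_max_right _ _).trans h8))⟩

/-- The sets of comparisons that occur in divisions with the invariant. -/
def invariantSystems (v : Fin 4 → ℝ → ℝ → ℝ) : Set (Set (Fin 4 × Fin 4 × Fin 4)) :=
  comparisons v '' {d | d ∈ divisions ∧ Invariant v d}

/-- The invariant is a finite disjunction of finite systems of comparisons. -/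
lemma setOf_invariant_eq (v : Fin 4 → ℝ → ℝ → ℝ) :
    {d | d ∈ divisions ∧ Invariant v d} = ⋃ Q ∈ invariantSystems v, comparisonSet v Q := by
  ext d
  simp only [mem_iUnion₂, exists_prop]
  constructor
  · exact fun h => ⟨_, ⟨d, h, rfl⟩, h.1, Subset.rfl⟩
  · rintro ⟨_, ⟨d', h', rfl⟩, h1, h2⟩
    exact ⟨h1, h'.2.mono h2⟩

lemma isClosed_comparisonSet {v : Fin 4 → ℝ → ℝ → ℝ} (hv : ∀ i, IsValuation (v i))
    (Q : Set (Fin 4 × Fin 4 × Fin 4)) : IsClosed (comparisonSet v Q) := by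
  have : comparisonSet v Q = divisions ∩ ⋂ p ∈ Q,
      {d | d ∈ divisions ∧ pieceValue (v p.1) d p.2.1 ≤ pieceValue (v p.1) d p.2.2} := by
    ext d
    simp only [comparisonSet, mem_ofPred_eq, mem_inter_iff, mem_iInter₂]
    exact ⟨fun h => ⟨h.1, fun p hp => ⟨h.1, h.2 hp⟩⟩, fun h => ⟨h.1, fun p hp => (h.2 p hp).2⟩⟩
  rw [this]
  exact isCompact_divisions.isClosed.inter (isClosed_biInter fun p _ =>
    isCompact_divisions.isClosed.isClosed_le ((hv _).continuousOn_pieceValue _)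
      ((hv _).continuousOn_pieceValue _))

/-- The value of the favorite pieces, as a function of the division; it is the only number that
satisfies `HasFavoriteValue`. -/
noncomputable def favoriteValue (v : ℝ → ℝ → ℝ) (d : ℝ × ℝ × ℝ) : ℝ :=
  Finset.univ.sup' Finset.univ_nonempty (pieceValue v d)

lemma pieceValue_le_favoriteValue (v : ℝ → ℝ → ℝ) (d : ℝ × ℝ × ℝ) (t : Fin 4) :
    pieceValue v d t ≤ favoriteValue v d :=
  Finset.le_sup' _ (Finset.mem_univ t)

lemma WeaklyPrefers.favoriteValue_eq {v : ℝ → ℝ → ℝ} {d : ℝ × ℝ × ℝ} {t : Fin 4}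
    (h : WeaklyPrefers v d t) : favoriteValue v d = pieceValue v d t :=
  le_antisymm (Finset.sup'_le _ _ fun s _ => h s) (pieceValue_le_favoriteValue v d t)

lemma hasFavoriteValue_favoriteValue (v : ℝ → ℝ → ℝ) (d : ℝ × ℝ × ℝ) :
    HasFavoriteValue v d (favoriteValue v d) := by
  obtain ⟨t, ht⟩ := exists_weaklyPrefers v d
  refine ⟨⟨t, ht.favoriteValue_eq.symm⟩, ?_⟩
  rintro _ ⟨s, rfl⟩
  exact pieceValue_le_favoriteValue v d s

lemma IsValuation.continuousOn_favoriteValue {v : ℝ → ℝ → ℝ} (hv : IsValuation v) :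
    ContinuousOn (favoriteValue v) divisions :=
  ContinuousOn.finset_sup'_apply _ fun t _ => hv.continuousOn_pieceValue t

/-- Under the invariant, no favorite piece of Agent 1 is the whole cake, since there is another. -/
lemma Invariant.favoriteValue_lt_one {v : Fin 4 → ℝ → ℝ → ℝ} (hv : ∀ i, IsValuation (v i))
    (hh : ∀ i, IsHungryVal (v i)) {d : ℝ × ℝ × ℝ} (hd : d ∈ divisions) (h : Invariant v d) :
    favoriteValue (v 0) d < 1 := by
  obtain ⟨t, t', htt', ht, ht'⟩ : ∃ t t' : Fin 4, t < t' ∧ WeaklyPrefers (v 0) d t ∧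
      WeaklyPrefers (v 0) d t' := by
    have h0 : ∃ k k', ∀ t, t ≠ k → t ≠ k' → WeaklyPrefers (v 0) d t := by
      rcases h with ⟨k, h1, -⟩ | ⟨k, k', -, h1, -⟩
      · exact ⟨k, k, fun t ht _ => weaklyPrefers_of_three_pieces_eq h1 t ht⟩
      · exact ⟨k, k', weaklyPrefers_of_two_pieces_eq h1⟩
    obtain ⟨k, k', h0⟩ := h0
    obtain ⟨t, t', h1, h2, h3, h4, h5⟩ : ∃ t t' : Fin 4, t < t' ∧ t ≠ k ∧ t ≠ k' ∧ t' ≠ k ∧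
        t' ≠ k' := by
      clear * -; revert k k'; decide
    exact ⟨t, t', h1, h0 t h2 h3, h0 t' h4 h5⟩
  have hpos := ht'.pos (hv 0) (hh 0) hd
  have hlt : cutPoint d t'.castSucc < cutPoint d t'.succ := by
    by_contra hle
    exact hpos.ne' ((hv 0).eq_zero _ (cutPoint_mem hd _) _ (cutPoint_mem hd _) (not_lt.1 hle))
  have hmono : Monotone (cutPoint d) := Fin.monotone_iff_le_succ.2 (cutPoint_le hd)
  have hle : cutPoint d t.succ ≤ cutPoint d t'.castSucc := hmono (Fin.succ_le_castSucc_iff.2 htt')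
  rw [ht.favoriteValue_eq]
  refine ((hh 0) _ _ 0 1 le_rfl (cutPoint_mem hd _).1 (cutPoint_le hd t) (cutPoint_mem hd _).2 le_rfl
    (Or.inr ?_)).trans_le ((hv 0).mem_Icc 0 (by simp) 1 (by simp)).2
  exact hle.trans_lt (hlt.trans_le (cutPoint_mem hd _).2)

/-! ### Existence of envy-free divisions -/

lemma IsEquipartition.isEnvyFreeDivision_or_conditionA {v : Fin 4 → ℝ → ℝ → ℝ} {d : ℝ × ℝ × ℝ}
    (he : IsEquipartition (v 0) d) : IsEnvyFreeDivision v d ∨ ConditionA v d := by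
  by_contra! hcon
  obtain ⟨k, hk⟩ := exists_twoOthers_of_not_isEnvyFreeDivision (fun t s => (he s t).le) hcon.1
  exact hcon.2 ⟨k, fun t t' _ _ => ⟨he t t', (he k t).le⟩, hk⟩

/-- Among the divisions with the invariant, one in which Agent 1's favorite pieces are worth most is
envy-free. -/
lemma exists_isEnvyFreeDivision_of_isHungryVal {v : Fin 4 → ℝ → ℝ → ℝ}
    (hv : ∀ i, IsValuation (v i)) (hh : ∀ i, IsHungryVal (v i)) :
    ∃ d ∈ divisions, IsEnvyFreeDivision v d := by
  obtain ⟨d₀, hd₀, he⟩ := exists_isEquipartition (hv 0) (hh 0)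
  rcases he.isEnvyFreeDivision_or_conditionA with h | h
  · exact ⟨d₀, hd₀, h⟩
  have hS : IsCompact {d | d ∈ divisions ∧ Invariant v d} := by
    refine isCompact_divisions.of_isClosed_subset ?_ fun d hd => hd.1
    rw [setOf_invariant_eq]
    exact (toFinite _).isClosed_biUnion fun Q _ => isClosed_comparisonSet hv Q
  obtain ⟨d, ⟨hd, hinv⟩, hmax⟩ := hS.exists_isMaxOn ⟨d₀, hd₀, Or.inl h⟩
    ((hv 0).continuousOn_favoriteValue.mono fun d hd => hd.1)
  refine ⟨d, hd, ?_⟩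
  by_contra hne
  have hcl := mem_closure_of_not_isEnvyFreeDivision hv hh hd hinv hne
    (hasFavoriteValue_favoriteValue _ _)
  obtain ⟨d', hd', hinv', t, ht⟩ := closure_nonempty_iff.1 ⟨d, hcl⟩
  exact (ht.trans_le (pieceValue_le_favoriteValue _ _ t)).not_ge (hmax ⟨hd', hinv'⟩)

/-- The valuation `v` mixed with a portion `ε` of the length of the interval. -/
def mixWithLength (v : ℝ → ℝ → ℝ) (ε : ℝ) (a b : ℝ) : ℝ := (1 - ε) * v a b + ε * max 0 (b - a)

lemma IsValuation.mixWithLength {v : ℝ → ℝ → ℝ} (hv : IsValuation v) {ε : ℝ} (h0 : 0 ≤ ε)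
    (h1 : ε ≤ 1) : IsValuation (mixWithLength v ε) where
  mem_Icc a ha b hb := by
    have h := hv.mem_Icc a ha b hb
    have h2 : max 0 (b - a) ∈ Icc (0 : ℝ) 1 :=
      ⟨le_max_left _ _, max_le zero_le_one (by linarith [ha.1, hb.2])⟩
    exact (convex_Icc (0 : ℝ) 1) h h2 (by linarith) h0 (by ring)
  eq_zero a ha b hb hba := by
    simp [_root_.mixWithLength, hv.eq_zero a ha b hb hba, hba]
  continuousOn := by
    have := hv.continuousOn
    unfold _root_.mixWithLength
    fun_prop

lemma IsMonotoneVal.isHungryVal_mixWithLength {v : ℝ → ℝ → ℝ} (hm : IsMonotoneVal v) {ε : ℝ}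
    (h0 : 0 < ε) (h1 : ε ≤ 1) : IsHungryVal (mixWithLength v ε) := by
  intro a b a' b' ha' haa' hab hbb' hb' hlt
  have h2 := mul_le_mul_of_nonneg_left (hm a b a' b' ha' haa' hab hbb' hb') (sub_nonneg.2 h1)
  have h3 : b - a < b' - a' := by rcases hlt with h | h <;> linarith
  have h4 := mul_lt_mul_of_pos_left h3 h0
  simp only [mixWithLength]
  rw [max_eq_right (by linarith), max_eq_right (by linarith)]
  linarith

lemma exists_isEnvyFreeDivision_of_isMonotoneVal {v : Fin 4 → ℝ → ℝ → ℝ}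
    (hv : ∀ i, IsValuation (v i)) (hm : ∀ i, IsMonotoneVal (v i)) :
    ∃ d ∈ divisions, IsEnvyFreeDivision v d := by
  let ε : ℕ → ℝ := fun n => 1 / ((n : ℝ) + 1)
  have hε : Tendsto ε atTop (𝓝 0) := tendsto_one_div_add_atTop_nhds_zero_nat
  have hε0 : ∀ n, 0 < ε n := fun n => Nat.one_div_pos_of_nat
  have hε1 : ∀ n, ε n ≤ 1 := fun n => by
    simp only [ε]
    rw [div_le_one (by positivity)]
    linarith [n.cast_nonneg (α := ℝ)]
  have hex : ∀ n, ∃ d ∈ divisions, IsEnvyFreeDivision (fun i => mixWithLength (v i) (ε n)) d :=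
    fun n => exists_isEnvyFreeDivision_of_isHungryVal
      (fun i => (hv i).mixWithLength (hε0 n).le (hε1 n))
      fun i => (hm i).isHungryVal_mixWithLength (hε0 n) (hε1 n)
  choose u hu hEF using hex
  obtain ⟨d, hd, φ, hφ, hlim⟩ := isCompact_divisions.tendsto_subseq hu
  refine ⟨d, hd, ?_⟩
  have hpv : ∀ i t, Tendsto (fun n => pieceValue (mixWithLength (v i) (ε (φ n))) (u (φ n)) t) atTop
      (𝓝 (pieceValue (v i) d t)) := by
    intro i t
    have h1 : Tendsto (fun n => pieceValue (v i) (u (φ n)) t) atTop (𝓝 (pieceValue (v i) d t)) :=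
      ((hv i).continuousOn_pieceValue t d hd).tendsto.comp
        (tendsto_nhdsWithin_iff.2 ⟨hlim, Eventually.of_forall fun n => hu _⟩)
    have h2 : Tendsto (fun n => max 0 (cutPoint (u (φ n)) t.succ - cutPoint (u (φ n)) t.castSucc))
        atTop (𝓝 (max 0 (cutPoint d t.succ - cutPoint d t.castSucc))) :=
      ((continuous_const.max ((continuous_cutPoint t.succ).sub
        (continuous_cutPoint t.castSucc))).tendsto d).comp hlim
    have h3 := hε.comp hφ.tendsto_atTop
    have := ((tendsto_const_nhds (x := (1 : ℝ))).sub h3).mul h1 |>.add (h3.mul h2)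
    rw [sub_zero, one_mul, zero_mul, add_zero] at this
    exact this
  -- An assignment with envy in the limit has envy for all large `n`.
  by_contra hne
  have hev : ∀ᶠ n in atTop, ∀ σ : Equiv.Perm (Fin 4),
      ¬ IsEnvyFreeAllocation (fun i => mixWithLength (v i) (ε (φ n))) (u (φ n)) σ := by
    refine eventually_all.2 fun σ => ?_
    have hσ : ¬ IsEnvyFreeAllocation v d σ := fun h => hne ⟨σ, h⟩
    simp only [IsEnvyFreeAllocation] at hσ
    push Not at hσ
    obtain ⟨i, j, hij⟩ := hσ
    filter_upwards [(hpv i (σ i)).eventually_lt (hpv i (σ j)) hij] with n hn h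
    exact (h i j).not_gt hn
  obtain ⟨n, hn⟩ := hev.exists
  obtain ⟨σ, hσ⟩ := hEF (φ n)
  exact hn σ hσ

/-! ### Paths in a finite union of convex sets -/

/-- A path along which `φ` increases can be built from segments: leave each of the convex sets at a
point where `φ` is maximal, so that no set is used twice. -/
lemma exists_increasing_path {E ι : Type*} [NormedAddCommGroup E] [NormedSpace ℝ E] [Finite ι]
    {K : ι → Set E} (hK : ∀ j, IsCompact (K j)) (hconv : ∀ j, Convex ℝ (K j)) {φ : E → ℝ}
    (hφ : ∀ j, ContinuousOn φ (K j))
    (haff : ∀ j, ∀ x ∈ K j, ∀ y ∈ K j, ∀ a b : ℝ, 0 ≤ a → 0 ≤ b → a + b = 1 →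
      φ (a • x + b • y) = a * φ x + b * φ y) {P : E → Prop}
    (hP : ∀ x ∈ ⋃ j, K j, ¬ P x → x ∈ closure (⋃ j, {y | y ∈ K j ∧ φ x < φ y})) :
    ∀ x ∈ ⋃ j, K j, ∃ β, φ x ≤ β ∧ ∃ T : ℝ → E, ContinuousOn T (Icc (φ x) β) ∧ T (φ x) = x ∧
      (∀ α ∈ Icc (φ x) β, T α ∈ (⋃ j, K j) ∧ φ (T α) = α) ∧ P (T β) := by
  have main : ∀ n, ∀ x ∈ ⋃ j, K j, {j | ∃ y ∈ K j, φ x < φ y}.ncard = n →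
      ∃ β, φ x ≤ β ∧ ∃ T : ℝ → E, ContinuousOn T (Icc (φ x) β) ∧ T (φ x) = x ∧
      (∀ α ∈ Icc (φ x) β, T α ∈ (⋃ j, K j) ∧ φ (T α) = α) ∧ P (T β) := by
    intro n
    induction n using Nat.strong_induction_on with
    | _ n ih =>
      intro x hx hn
      by_cases hPx : P x
      · refine ⟨φ x, le_rfl, fun _ => x, continuousOn_const, rfl, fun α hα => ⟨hx, ?_⟩, hPx⟩
        exact le_antisymm hα.1 hα.2
      have hcl := hP x hx hPx
      rw [closure_iUnion_of_finite, mem_iUnion] at hcl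
      obtain ⟨j, hj⟩ := hcl
      have hxj : x ∈ K j :=
        closure_minimal (fun y hy => hy.1) (hK j).isClosed hj
      obtain ⟨y, hy, hxy⟩ := closure_nonempty_iff.1 ⟨x, hj⟩
      obtain ⟨z, hz, hmax⟩ := (hK j).exists_isMaxOn ⟨y, hy⟩ (hφ j)
      have hxz : φ x < φ z := hxy.trans_le (hmax hy)
      have hlt : {j | ∃ y ∈ K j, φ z < φ y}.ncard < n := by
        rw [← hn]
        refine ncard_lt_ncard ⟨fun i ⟨y, hy, h⟩ => ⟨y, hy, hxz.trans h⟩, fun hsub => ?_⟩ (toFinite _)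
        obtain ⟨y', hy', h⟩ := hsub (show j ∈ _ from ⟨y, hy, hxy⟩)
        exact h.not_ge (hmax hy')
      obtain ⟨β, hβ, T, hT, hTz, hTα, hPT⟩ := ih _ hlt z (mem_iUnion.2 ⟨j, hz⟩) rfl
      let c : ℝ → ℝ := fun α => (α - φ x) / (φ z - φ x)
      let s : ℝ → E := fun α => (1 - c α) • x + c α • z
      have hpos : 0 < φ z - φ x := sub_pos.2 hxz
      have hcc : Continuous c := by fun_prop
      have hs : Continuous s := by fun_prop
      have hc0 : c (φ x) = 0 := by simp [c]
      have hc1 : c (φ z) = 1 := div_self hpos.ne'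
      have hsx : s (φ x) = x := by simp [s, hc0]
      have hsz : s (φ z) = z := by simp [s, hc1]
      have hsα : ∀ α ∈ Icc (φ x) (φ z), s α ∈ K j ∧ φ (s α) = α := by
        intro α hα
        have h0 : 0 ≤ c α := div_nonneg (sub_nonneg.2 hα.1) hpos.le
        have h1 : 0 ≤ 1 - c α := sub_nonneg.2 ((div_le_one hpos).2 (by linarith [hα.2]))
        refine ⟨hconv j hxj hz h1 h0 (by ring), ?_⟩
        rw [haff j x hxj z hz _ _ h1 h0 (by ring)]
        simp only [c]
        field_simp
        ring
      let T' : ℝ → E := fun α => if α ≤ φ z then s α else T α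
      have e1 : EqOn T' s (Icc (φ x) (φ z)) := fun α hα => if_pos hα.2
      have e2 : EqOn T' T (Icc (φ z) β) := by
        intro α hα
        rcases hα.1.eq_or_lt with h | h
        · simp only [T', ← h, le_refl, if_true, hsz, hTz]
        · exact if_neg h.not_ge
      refine ⟨β, hxz.le.trans hβ, T', ?_, (e1 ⟨le_rfl, hxz.le⟩).trans hsx, fun α hα => ?_, ?_⟩
      · rw [← Icc_union_Icc_eq_Icc hxz.le hβ]
        exact (hs.continuousOn.congr e1).union_of_isClosed (hT.congr e2) isClosed_Icc isClosed_Icc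
      · rcases le_total α (φ z) with h | h
        · rw [e1 ⟨hα.1, h⟩]
          exact ⟨mem_iUnion.2 ⟨j, (hsα α ⟨hα.1, h⟩).1⟩, (hsα α ⟨hα.1, h⟩).2⟩
        · rw [e2 ⟨h, hα.2⟩]
          exact hTα α ⟨h, hα.2⟩
      · rwa [e2 ⟨hβ, le_rfl⟩]
  exact fun x hx => main _ x hx rfl

/-! ### Cells of linearity -/

/-- The divisions whose `t`-th piece, as a point of the plane, lies in the polytope spanned by
`c i t`, for each agent `i` and each `t`. -/
def linearityCell (c : Fin 4 → Fin 4 → Finset (ℝ × ℝ)) : Set (ℝ × ℝ × ℝ) :=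
  {d | d ∈ divisions ∧ ∀ i t,
    (cutPoint d t.castSucc, cutPoint d t.succ) ∈ convexHull ℝ (c i t : Set (ℝ × ℝ))}

lemma cutPoint_combo {a b : ℝ} (hab : a + b = 1) (d d' : ℝ × ℝ × ℝ) (t : Fin 5) :
    cutPoint (a • d + b • d') t = a * cutPoint d t + b * cutPoint d' t := by
  fin_cases t <;> simp [cutPoint, hab]

lemma isClosed_linearityCell (c : Fin 4 → Fin 4 → Finset (ℝ × ℝ)) :
    IsClosed (linearityCell c) := by
  have : linearityCell c = divisions ∩ ⋂ i, ⋂ t, (fun d : ℝ × ℝ × ℝ =>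
      (cutPoint d (Fin.castSucc t), cutPoint d t.succ)) ⁻¹'
        convexHull ℝ (c i t : Set (ℝ × ℝ)) := by
    ext d
    simp [linearityCell]
  rw [this]
  exact isCompact_divisions.isClosed.inter (isClosed_iInter fun i => isClosed_iInter fun t =>
    ((c i t).finite_toSet.isCompact_convexHull ℝ).isClosed.preimage
      ((continuous_cutPoint _).prodMk (continuous_cutPoint _)))

lemma convex_linearityCell (c : Fin 4 → Fin 4 → Finset (ℝ × ℝ)) : Convex ℝ (linearityCell c) := by
  intro d hd d' hd' a b ha hb hab
  refine ⟨convex_divisions hd.1 hd'.1 ha hb hab, fun i t => ?_⟩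
  rw [cutPoint_combo hab, cutPoint_combo hab]
  exact convex_convexHull ℝ (c i t : Set (ℝ × ℝ)) (hd.2 i t) (hd'.2 i t) ha hb hab

/-- On a cell of linearity, all piece values are affine functions of the division. -/
lemma pieceValue_combo {v : ℝ → ℝ → ℝ} {c : Fin 4 → Fin 4 → Finset (ℝ × ℝ)} {i : Fin 4}
    (hc : ∀ t, ∃ x y z : ℝ, ∀ p ∈ convexHull ℝ (c i t : Set (ℝ × ℝ)),
      v p.1 p.2 = x * p.1 + y * p.2 + z) {d d' : ℝ × ℝ × ℝ} (hd : d ∈ linearityCell c)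
    (hd' : d' ∈ linearityCell c) {a b : ℝ} (ha : 0 ≤ a) (hb : 0 ≤ b) (hab : a + b = 1)
    (t : Fin 4) :
    pieceValue v (a • d + b • d') t = a * pieceValue v d t + b * pieceValue v d' t := by
  obtain ⟨x, y, z, h⟩ := hc t
  have h1 := h _ (hd.2 i t)
  have h2 := h _ (hd'.2 i t)
  have h3 := h _ ((convex_linearityCell c hd hd' ha hb hab).2 i t)
  simp only [pieceValue] at *
  rw [h1, h2, h3, cutPoint_combo hab, cutPoint_combo hab]
  linear_combination (-z) * hab

/-- The path for piecewise linear hungry valuations, in terms of `favoriteValue`. The sets for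
`exists_increasing_path` are cut out by comparisons between piece values, which are affine on each
cell of linearity. -/
theorem exists_path_of_isPiecewiseLinearVal {v : Fin 4 → ℝ → ℝ → ℝ} (hv : ∀ i, IsValuation (v i))
    (hh : ∀ i, IsHungryVal (v i)) (hpl : ∀ i, IsPiecewiseLinearVal (v i)) {d₀ : ℝ × ℝ × ℝ}
    (hd₀ : d₀ ∈ divisions) (hinv : Invariant v d₀) :
    ∃ β, favoriteValue (v 0) d₀ ≤ β ∧ ∃ T : ℝ → ℝ × ℝ × ℝ,
      ContinuousOn T (Icc (favoriteValue (v 0) d₀) β) ∧ T (favoriteValue (v 0) d₀) = d₀ ∧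
      (∀ α ∈ Icc (favoriteValue (v 0) d₀) β,
        T α ∈ {d | d ∈ divisions ∧ Invariant v d} ∧ favoriteValue (v 0) (T α) = α) ∧
      IsEnvyFreeDivision v (T β) := by
  choose P hPU hPaff using hpl
  -- A set `K` is given by comparisons that enforce the invariant, and by a cell of linearity.
  let K : (invariantSystems v × ((i : Fin 4) → Fin 4 → P i)) → Set (ℝ × ℝ × ℝ) :=
    fun j => comparisonSet v j.1 ∩ linearityCell fun i t => j.2 i t
  have hUnion : ⋃ j, K j = {d | d ∈ divisions ∧ Invariant v d} := by
    rw [setOf_invariant_eq]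
    ext d
    simp only [mem_iUnion, exists_prop, K]
    constructor
    · rintro ⟨⟨Q, c⟩, hQ, -⟩
      exact ⟨Q, Q.2, hQ⟩
    · rintro ⟨Q, hQ, hd⟩
      have hcell : ∀ i t, ∃ s : P i,
          (cutPoint d (Fin.castSucc t), cutPoint d t.succ) ∈
            convexHull ℝ ((s : Finset (ℝ × ℝ)) : Set (ℝ × ℝ)) := by
        intro i t
        have hmem : (cutPoint d (Fin.castSucc t), cutPoint d t.succ) ∈
            ⋃ s ∈ P i, convexHull ℝ (s : Set (ℝ × ℝ)) := by
          rw [hPU i]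
          exact ⟨(cutPoint_mem hd.1 t.castSucc).1, cutPoint_le hd.1 t, (cutPoint_mem hd.1 t.succ).2⟩
        obtain ⟨s, hs, h⟩ := mem_iUnion₂.1 hmem
        exact ⟨⟨s, hs⟩, h⟩
      choose c hc using hcell
      exact ⟨(⟨Q, hQ⟩, c), hd, hd.1, hc⟩
  have hpv : ∀ (c : (i : Fin 4) → Fin 4 → P i), ∀ d ∈ linearityCell (fun i t => c i t),
      ∀ d' ∈ linearityCell (fun i t => c i t), ∀ a b : ℝ, 0 ≤ a → 0 ≤ b → a + b = 1 → ∀ i t,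
      pieceValue (v i) (a • d + b • d') t =
        a * pieceValue (v i) d t + b * pieceValue (v i) d' t :=
    fun c d hd d' hd' a b ha hb hab i t =>
      pieceValue_combo (i := i) (fun t => hPaff i _ (c i t).2) hd hd' ha hb hab t
  have hconv : ∀ j, Convex ℝ (K j) := by
    rintro ⟨Q, c⟩ d ⟨hd, hdc⟩ d' ⟨hd', hdc'⟩ a b ha hb hab
    refine ⟨⟨convex_divisions hd.1 hd'.1 ha hb hab, fun p hp => ?_⟩,
      convex_linearityCell _ hdc hdc' ha hb hab⟩
    have h1 := hd.2 hp
    have h2 := hd'.2 hp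
    simp only [comparisons, mem_ofPred_eq] at h1 h2 ⊢
    rw [hpv c d hdc d' hdc' a b ha hb hab, hpv c d hdc d' hdc' a b ha hb hab]
    gcongr
  have hcompact : ∀ j, IsCompact (K j) := fun j => isCompact_divisions.of_isClosed_subset
    ((isClosed_comparisonSet hv _).inter (isClosed_linearityCell _)) fun d hd => hd.1.1
  have haff : ∀ j, ∀ d ∈ K j, ∀ d' ∈ K j, ∀ a b : ℝ, 0 ≤ a → 0 ≤ b → a + b = 1 →
      favoriteValue (v 0) (a • d + b • d') =
        a * favoriteValue (v 0) d + b * favoriteValue (v 0) d' := by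
    intro j d hd d' hd' a b ha hb hab
    -- The comparisons fix a favorite piece of Agent 1.
    obtain ⟨t, ht⟩ : ∃ t, ∀ e ∈ K j, WeaklyPrefers (v 0) e t := by
      obtain ⟨⟨_, d₁, -, rfl⟩, c⟩ := j
      obtain ⟨t, ht⟩ := exists_weaklyPrefers (v 0) d₁
      exact ⟨t, fun e he s => he.1.2 (show (0, s, t) ∈ comparisons v d₁ from ht s)⟩
    rw [(ht _ (hconv j hd hd' ha hb hab)).favoriteValue_eq, (ht d hd).favoriteValue_eq,
      (ht d' hd').favoriteValue_eq]
    exact hpv j.2 d hd.2 d' hd'.2 a b ha hb hab 0 t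
  have := exists_increasing_path hcompact hconv
    (fun j => (hv 0).continuousOn_favoriteValue.mono fun d hd => hd.1.1) haff
    (P := IsEnvyFreeDivision v) (fun d hd hne => ?_) d₀ (by rw [hUnion]; exact ⟨hd₀, hinv⟩)
  · simpa only [hUnion] using this
  · rw [hUnion] at hd
    refine closure_mono ?_ (mem_closure_of_not_isEnvyFreeDivision hv hh hd.1 hd.2 hne
      (hasFavoriteValue_favoriteValue _ _))
    rintro e ⟨he, hinv', t, ht⟩
    have hmem : e ∈ ⋃ j, K j := by rw [hUnion]; exact ⟨he, hinv'⟩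
    obtain ⟨j, hj⟩ := mem_iUnion.1 hmem
    exact mem_iUnion.2 ⟨j, hj, ht.trans_le (pieceValue_le_favoriteValue _ _ t)⟩

theorem theorem4p1 :
    -- existence of a connected envy-free allocation for four monotone agents
    (∀ v : Fin 4 → ℝ → ℝ → ℝ, (∀ i, IsValuation (v i)) → (∀ i, IsMonotoneVal (v i)) →
      ∃ d ∈ divisions, ∃ σ : Equiv.Perm (Fin 4), IsEnvyFreeAllocation v d σ) ∧
    -- the starting point: Agent 1's equipartition
    (∀ v : Fin 4 → ℝ → ℝ → ℝ, (∀ i, IsValuation (v i)) → (∀ i, IsHungryVal (v i)) →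
      (∃! d : ℝ × ℝ × ℝ, d ∈ divisions ∧ IsEquipartition (v 0) d) ∧
      ∀ d ∈ divisions, IsEquipartition (v 0) d →
        IsEnvyFreeDivision v d ∨ ConditionA v d) ∧
    -- the continuous path from any division that satisfies the invariant
    (∀ v : Fin 4 → ℝ → ℝ → ℝ, (∀ i, IsValuation (v i)) → (∀ i, IsHungryVal (v i)) →
      (∀ i, IsPiecewiseLinearVal (v i)) →
      ∀ d₀ ∈ divisions, ∀ α₀ : ℝ, Invariant v d₀ → HasFavoriteValue (v 0) d₀ α₀ →
        ∃ α₁ ∈ Set.Ico α₀ 1, ∃ T : ℝ → ℝ × ℝ × ℝ,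
          ContinuousOn T (Set.Icc α₀ α₁) ∧
          T α₀ = d₀ ∧
          (∀ α ∈ Set.Icc α₀ α₁,
            T α ∈ divisions ∧ Invariant v (T α) ∧ HasFavoriteValue (v 0) (T α) α) ∧
          IsEnvyFreeDivision v (T α₁)) := by
  refine ⟨fun v hv hm => exists_isEnvyFreeDivision_of_isMonotoneVal hv hm, fun v hv hh => ⟨?_, ?_⟩,
    fun v hv hh hpl d₀ hd₀ α₀ hinv hα₀ => ?_⟩
  · obtain ⟨d, hd, he⟩ := exists_isEquipartition (hv 0) (hh 0)
    exact ⟨d, ⟨hd, he⟩, fun d' h => h.2.unique (hh 0) h.1 hd he⟩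
  · exact fun d _ he => he.isEnvyFreeDivision_or_conditionA
  · obtain rfl : favoriteValue (v 0) d₀ = α₀ :=
      (hasFavoriteValue_favoriteValue _ _).unique hα₀
    obtain ⟨β, hβ, T, hT, hT0, hTα, hEF⟩ := exists_path_of_isPiecewiseLinearVal hv hh hpl hd₀ hinv
    have hlast := hTα β ⟨hβ, le_rfl⟩
    refine ⟨β, ⟨hβ, ?_⟩, T, hT, hT0, fun α hα => ?_, hEF⟩
    · exact hlast.2 ▸ hlast.1.2.favoriteValue_lt_one hv hh hlast.1.1
    · obtain ⟨⟨h1, h2⟩, h3⟩ := hTα α hα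
      have h4 := hasFavoriteValue_favoriteValue (v 0) (T α)
      rw [h3] at h4
      exact ⟨h1, h2, h4⟩
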